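/- Let $M_0,M_1\ge 1$ be integers, let $\mathbb S=\{(k,i): k\ge 0,\ 1\le i\le M_{\min(k,1)}\}$, and let $\{(X_n,J_n)\}_{n\ge 0}$ be a Markov chain on $\mathbb S$ of M/G/1 type: its transition matrix $P$ is stochastic and has the blocks (between level $k$ and level $l$) $P(0;0)=B(0)$, $P(0;l)=B(l)$ for $l\ge1$, $P(1;0)=B(-1)$, $P(k;0)=O$ for $k\ge 2$, and, for $k,l\ge 1$, $P(k;l)=A(l-k)$ if $l\ge k-1$ and $P(k;l)=O$ otherwise. Let $e$ denote the column vector of ones, and let $\mathbb E_x$ and $\mathbb P_x$ refer to the chain started at $x\in\mathbb S$. Assume: (i) $P$ is irreducible; (ii) $A:=\sum_{k\ge-1}A(k)$ is an irreducible stochastic matrix; (iii) $\sum_{k\ge1}kB(k)e<\infty$; (iv) $\overline m_A:=\sum_{k\ge-1}kA(k)e$ is finite and $\sigma:=\varpi\,\overline m_A<0$, where $\varpi$ is the stationary probability vector of $A$. Let $\pi=(\pi(0),\pi(1),\dots)$ be the stationary distribution of $P$, split into levels. For $k\ge0$ put $\overline A(k)=\sum_{\ell>k}A(\ell)$, $\overline{\overline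 A}(k)=\sum_{\ell>k}\overline A(\ell)$, and define $\overline B,\overline{\overline B}$ in the same way. Let $T_k=\inf\{n\ge1:X_n=k\}$ and $T_x=\inf\{n\ge1:(X_n,J_n)=x\}$. Define - $G_{i,j}=\mathbb P_{(2,i)}\big(T_1<\infty,\ (X_{T_1},J_{T_1})=(1,j)\big)$ for $1\le i,j\le M_1$, and let $g$ be the stationary probability vector of $G$; - $\Phi(0)=\sum_{m\ge0}A(m)G^m$; - $F_+(x;y)=\mathbb E_x\big[\sum_{\nu=0}^{T_0-1}\mathbf 1((X_\nu,J_\nu)=y)\big]$, with blocks $F_+(k;l)$; - for a fixed but arbitrary $s\in\mathbb S$, $H(x;y)=\mathbb E_x\big[\sum_{\nu=0}^{T_s-1}\mathbf 1((X_\nu,J_\nu)=y)\big]-\pi(y)\,\mathbb E_x[T_s]$, with blocks $H(k;l)$; - $S(k)=(I-\Phi(0))^{-1}B(-1)H(0;k)+G(I-A-\overline m_A\,g)^{-1}e\,\pi(k)$ for $k\ge 0$. For $N\ge1$ let $P^{(N)}$ be the level-increment truncation of $P$, that is, the matrix with the same block structure in which $A(k)$ and $B(k)$ are kept for $-1\le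 k\le N-1$, are replaced by $\overline A(N-1)$ and $\overline B(N-1)$ for $k=N$, and by $O$ for $k>N$. Let $\pi^{(N)}$ be any stationary distribution of $P^{(N)}$. Then all the expectations, infinite series and inverses occurring here are finite, convergent and well defined, and for all $N\ge 1$ and $0\le k\le N$, $$\begin{aligned} \pi^{(N)}(k)-\pi(k) ={}&\pi^{(N)}(0)\Big[\tfrac1{-\sigma}\overline{\overline B}(N-1)\,e\,\pi(k) +\sum_{n=N+1}^\infty B(n)\big(G^{N-k}-G^{n-k}\big)F_+(k;k) +\sum_{n=N+1}^\infty B(n)\big(G^{N-1}-G^{n-1}\big)S(k)\Big]\\ &+\sum_{\ell=1}^\infty\pi^{(N)}(\ell)\Big[\tfrac1{-\sigma}\overline{\overline A}(N-1)\,e\,\pi(k) +\sum_{n=N+1}^\infty A(n)\big(G^{N+\ell-k}-G^{n+\ell-k}\big)F_+(k;k) +\sum_{n=N+1}^\infty A(n)\big(G^{N+\ell-1}-G^{n+\ell-1}\big)S(k)\Big], \end{aligned}$$ where for $k=0$ the two sums that contain $F_+(k;k)$ are absent. -/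

import Mathlib

open Matrix MeasureTheory
open scoped ENNReal

noncomputable section

namespace MG1

/-! ### General notions for stochastic matrices on a countable index set -/

/-- Nonnegative matrix (possibly infinite) all of whose rows sum to one. -/
def IsStochastic {S : Type*} (P : Matrix S S ℝ) : Prop :=
  (∀ x y, 0 ≤ P x y) ∧ ∀ x, HasSum (fun y => P x y) 1

/-- Irreducibility of a nonnegative matrix: every state can be reached from every state through
a finite sequence of transitions of positive probability. -/
def IsIrred {S : Type*} (P : Matrix S S ℝ) : Prop :=
  ∀ x y, Relation.ReflTransGen (fun u v => 0 < P u v) x y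

/-- `p` is a stationary probability vector of `P`: nonnegative, total mass one, `p P = p`. -/
structure IsStationary {S : Type*} (P : Matrix S S ℝ) (p : S → ℝ) : Prop where
  nonneg : ∀ x, 0 ≤ p x
  total : HasSum p 1
  invariant : ∀ y, HasSum (fun x => p x * P x y) (p y)

/-! ### State space and block structure -/

/-- Phases of level `k`: `M₀` phases at level `0`, `M₁` phases at every level `k ≥ 1`. -/
def Phase (M₀ M₁ : ℕ) : ℕ → Type
  | 0 => Fin M₀
  | _ + 1 => Fin M₁

/-- The states `(k, i)` with `k` a level and `i` a phase of level `k`. -/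
abbrev State (M₀ M₁ : ℕ) : Type := (k : ℕ) × Phase M₀ M₁ k

/-- The block matrices of an M/G/1-type transition matrix. -/
structure Blocks (M₀ M₁ : ℕ) where
  /-- `B(-1)` -/
  Bdown : Matrix (Fin M₁) (Fin M₀) ℝ
  /-- `B(0)` -/
  Bzero : Matrix (Fin M₀) (Fin M₀) ℝ
  /-- `B(k)` for `k ≥ 1`; the value at index `0` plays no role -/
  B : ℕ → Matrix (Fin M₀) (Fin M₁) ℝ
  /-- `A(-1)` -/
  Adown : Matrix (Fin M₁) (Fin M₁) ℝ
  /-- `A(k)` for `k ≥ 0` -/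
  A : ℕ → Matrix (Fin M₁) (Fin M₁) ℝ

variable {M₀ M₁ : ℕ}

namespace Blocks

/-- The upper block-Hessenberg matrix `P` built from the blocks. -/
def transition (D : Blocks M₀ M₁) : Matrix (State M₀ M₁) (State M₀ M₁) ℝ
  | ⟨0, i⟩, ⟨0, j⟩ => D.Bzero i j
  | ⟨0, i⟩, ⟨l + 1, j⟩ => D.B (l + 1) i j
  | ⟨1, i⟩, ⟨0, j⟩ => D.Bdown i j
  | ⟨_ + 2, _⟩, ⟨0, _⟩ => 0
  | ⟨k + 1, i⟩, ⟨l + 1, j⟩ =>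
      if k ≤ l then D.A (l - k) i j else if k = l + 1 then D.Adown i j else 0

/-- `A = ∑_{k ≥ -1} A(k)`. -/
def Asum (D : Blocks M₀ M₁) : Matrix (Fin M₁) (Fin M₁) ℝ := D.Adown + ∑' k, D.A k

/-- The mean drift vector `∑_{k ≥ -1} k A(k) e`. -/
def mA (D : Blocks M₀ M₁) : Fin M₁ → ℝ :=
  ∑' k : ℕ, (k : ℝ) • (D.A k *ᵥ 1) - D.Adown *ᵥ 1

/-- `Ā(k) = ∑_{ℓ ≥ k+1} A(ℓ)`. -/
def Abar (D : Blocks M₀ M₁) (k : ℕ) : Matrix (Fin M₁) (Fin M₁) ℝ := ∑' l, D.A (k + 1 + l)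

/-- `B̄(k) = ∑_{ℓ ≥ k+1} B(ℓ)`. -/
def Bbar (D : Blocks M₀ M₁) (k : ℕ) : Matrix (Fin M₀) (Fin M₁) ℝ := ∑' l, D.B (k + 1 + l)

/-- Doubly integrated tail `∑_{ℓ ≥ k+1} Ā(ℓ)`. -/
def Abarbar (D : Blocks M₀ M₁) (k : ℕ) : Matrix (Fin M₁) (Fin M₁) ℝ :=
  ∑' l, D.Abar (k + 1 + l)

/-- Doubly integrated tail `∑_{ℓ ≥ k+1} B̄(ℓ)`. -/
def Bbarbar (D : Blocks M₀ M₁) (k : ℕ) : Matrix (Fin M₀) (Fin M₁) ℝ :=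
  ∑' l, D.Bbar (k + 1 + l)

/-- Level-increment truncation at `N ≥ 1`: the blocks with index `≥ N` are lumped at index `N`. -/
def trunc (D : Blocks M₀ M₁) (N : ℕ) : Blocks M₀ M₁ where
  Bdown := D.Bdown
  Bzero := D.Bzero
  B := fun k => if k < N then D.B k else if k = N then D.Bbar (N - 1) else 0
  Adown := D.Adown
  A := fun k => if k < N then D.A k else if k = N then D.Abar (N - 1) else 0

/-- Standing assumption on the blocks, with `w` the stationary probability vector of `A`.
The summability of `k A(k) e` is what gives a meaning to the drift in the last condition. -/
structure Standing (D : Blocks M₀ M₁) (w : Fin M₁ → ℝ) : Prop where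
  stochastic : IsStochastic D.transition
  irreducible : IsIrred D.transition
  A_stochastic : IsStochastic D.Asum
  A_irreducible : IsIrred D.Asum
  B_moment : Summable fun k : ℕ => (k : ℝ) • (D.B k *ᵥ (1 : Fin M₁ → ℝ))
  A_moment : Summable fun k : ℕ => (k : ℝ) • (D.A k *ᵥ (1 : Fin M₁ → ℝ))
  w_stationary : IsStationary D.Asum w
  drift_neg : w ⬝ᵥ D.mA < 0

end Blocks

/-! ### The Markov chain and its functionals -/

variable {Ω : Type*} [MeasurableSpace Ω]

/-- Under `ℙ x`, the process `Z` is a Markov chain with transition matrix `P` started at `x`. -/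
structure IsMarkovChain {S : Type*} (P : Matrix S S ℝ) (ℙ : S → Measure Ω) (Z : ℕ → Ω → S) :
    Prop where
  prob : ∀ x, IsProbabilityMeasure (ℙ x)
  meas : ∀ n s, MeasurableSet {ω | Z n ω = s}
  start : ∀ x, ℙ x {ω | Z 0 ω = x} = 1
  step : ∀ (x : S) (n : ℕ) (z : ℕ → S),
    ℙ x {ω | ∀ m ≤ n + 1, Z m ω = z m} =
      ℙ x {ω | ∀ m ≤ n, Z m ω = z m} * ENNReal.ofReal (P (z n) (z (n + 1)))

/-- `inf {n ≥ 1 : Z_n ∈ C}`, with value `⊤` if there is no such `n`. -/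
def hitTime {S : Type*} (Z : ℕ → Ω → S) (C : Set S) (ω : Ω) : ℕ∞ :=
  ⨅ (n : ℕ) (_ : 1 ≤ n ∧ Z n ω ∈ C), (n : ℕ∞)

/-- Expected hitting time `E_x[T_C]`. -/
def meanHit {S : Type*} (ℙ : S → Measure Ω) (Z : ℕ → Ω → S) (C : Set S) (x : S) : ℝ≥0∞ :=
  ∫⁻ ω, (hitTime Z C ω : ℝ≥0∞) ∂(ℙ x)

open Classical in
/-- Expected number of visits `E_x[∑_{ν=0}^{T_C - 1} 1(Z_ν = y)]`. -/
def meanVisits {S : Type*} (ℙ : S → Measure Ω) (Z : ℕ → Ω → S) (C : Set S) (x y : S) : ℝ≥0∞ :=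
  ∫⁻ ω, (∑' n : ℕ, if (n : ℕ∞) < hitTime Z C ω ∧ Z n ω = y then (1 : ℝ≥0∞) else 0) ∂(ℙ x)

/-- The states of level `k`. -/
def levelSet (M₀ M₁ k : ℕ) : Set (State M₀ M₁) := {x | x.1 = k}

/-- The subvector of `p` of level `k`. -/
def levelVec (p : State M₀ M₁ → ℝ) (k : ℕ) : Phase M₀ M₁ k → ℝ := fun j => p ⟨k, j⟩

variable (ℙ : State M₀ M₁ → Measure Ω) (Z : ℕ → Ω → State M₀ M₁)

/-- The `G`-matrix: `G i j` is the probability that the chain started at `(2, i)` enters level `1`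
(in finite time) at the state `(1, j)`. -/
def Gmat : Matrix (Fin M₁) (Fin M₁) ℝ := fun i j =>
  (ℙ ⟨2, i⟩).real
    {ω | ∃ n : ℕ, hitTime Z (levelSet M₀ M₁ 1) ω = n ∧ Z n ω = (⟨1, j⟩ : State M₀ M₁)}

/-- `Φ(0) = ∑_{m ≥ 0} A(m) G^m`. -/
def Phi0 (D : Blocks M₀ M₁) : Matrix (Fin M₁) (Fin M₁) ℝ := ∑' m, D.A m * Gmat ℙ Z ^ m

/-- `F₊(x; y)`: expected number of visits to `y` before the first entry into level `0`. -/
def Fplus (x y : State M₀ M₁) : ℝ := (meanVisits ℙ Z (levelSet M₀ M₁ 0) x y).toReal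

/-- The diagonal block `F₊(k; k)` for `k ≥ 1`. For `k = 0` the term in which this block occurs is
absent, since level `0` is never visited before the entry into level `0` from a positive level;
this is encoded by the value `0`. -/
def FplusDiag : (k : ℕ) → Matrix (Fin M₁) (Phase M₀ M₁ k) ℝ
  | 0 => 0
  | k + 1 => fun i j => Fplus ℙ Z ⟨k + 1, i⟩ ⟨k + 1, j⟩

/-- `H(x; y)` relative to the reference state `s` and the stationary vector `p`. -/
def Hmat (p : State M₀ M₁ → ℝ) (s x y : State M₀ M₁) : ℝ :=
  (meanVisits ℙ Z {s} x y).toReal - p y * (meanHit ℙ Z {s} x).toReal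

/-- The block `H(0; k)`. -/
def Hzero (p : State M₀ M₁ → ℝ) (s : State M₀ M₁) (k : ℕ) :
    Matrix (Fin M₀) (Phase M₀ M₁ k) ℝ := fun i j => Hmat ℙ Z p s ⟨0, i⟩ ⟨k, j⟩

/-- `S(k) = (I - Φ(0))⁻¹ B(-1) H(0; k) + G (I - A - m_A g)⁻¹ e π(k)`. -/
def Smat (D : Blocks M₀ M₁) (p : State M₀ M₁ → ℝ) (g : Fin M₁ → ℝ) (s : State M₀ M₁) (k : ℕ) :
    Matrix (Fin M₁) (Phase M₀ M₁ k) ℝ :=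
  (1 - Phi0 ℙ Z D)⁻¹ * D.Bdown * Hzero ℙ Z p s k +
    vecMulVec (Gmat ℙ Z *ᵥ ((1 - D.Asum - vecMulVec D.mA g)⁻¹ *ᵥ 1)) (levelVec p k)

end MG1

end

/-! Fix a state y and let f be the column y of H. It solves the Poisson equation P f = f - 1_y +
π(y) (`IsStationary.poisson`). Replacing P by P^(N) adds a `gap` to P f: the mass moved from an
increment n > N to N contributes A(n)(f(N+ℓ) - f(n+ℓ)) at level ℓ ≥ 1 and B(n)(f(N) - f(n)) at level
0. Integrating P^(N) f - f against π^(N) gives zero, so the integral of the gap is π^(N)(y) - π(y)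
(`hasSum_mul_gap`). Here f grows linearly with the level and no first moment of π^(N) is available;
it suffices that f has bounded increments along the jumps of P^(N)
(`IsStationary.hasSum_increment`).

It remains to know f on level L ≥ max(k,1), where k is the level of y. With κ = (I - A - m_A g)⁻¹ e,
it is the column of G^(L-k) F₊(k;k) + G^(L-1) S(k), minus π(y) κ + π(y) L/(-σ) e
(`deviation_eq_pow`). In differences κ cancels, and the linear term produces the double tails
because ∑_{n>N} (n-N) A(n) is the doubly integrated tail at N-1.

All structural identities rest on one uniqueness principle (`toeplitz_unique_of_le_descent`): a
solution of φ(m+1) = ∑ₙ A(n-1) φ(m+n) with φ(0) = 0, dominated by an affine function of the mean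
descent time to level 0, vanishes. Indeed |φ| is subharmonic for the kernel K killed at level 0, so
|φ| ≤ Kⁿ(a + b ∑ Kᵐ 1), which tends to 0 since ∑ Kᵐ 1 is finite. Comparing two solutions then yields
the powers of G as entry probabilities, F₊(m;k) = G^(m-k) F₊(k;k), the formula κ - G^m κ + m/(-σ) e
for the descent times, the decomposition of H, and the injectivity of I - Φ(0).

Paths enter only to identify the functionals with potentials ∑ Kⁿ v of taboo kernels; no strong
Markov property is needed. Finiteness comes from p(s) E_s[T_s] ≤ 1, which irreducibility spreads to
all states. -/

noncomputable section

namespace MG1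

open Filter Topology

/-! ### Nonnegative kernels and their potentials -/

section Kernel

variable {S : Type*}

/-- The action of a nonnegative kernel on functions. -/
def act (K : S → S → ℝ≥0∞) (v : S → ℝ≥0∞) (x : S) : ℝ≥0∞ := ∑' z, K x z * v z

/-- The potential `∑ₙ Kⁿ v`. -/
def pot (K : S → S → ℝ≥0∞) (v : S → ℝ≥0∞) (x : S) : ℝ≥0∞ := ∑' n, (act K)^[n] v x

variable {K : S → S → ℝ≥0∞} {v w : S → ℝ≥0∞}

lemma act_mono (h : ∀ z, v z ≤ w z) (x : S) : act K v x ≤ act K w x :=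
  ENNReal.tsum_le_tsum fun z => by gcongr; exact h z

lemma iterate_act_mono (h : ∀ z, v z ≤ w z) (n : ℕ) (x : S) :
    (act K)^[n] v x ≤ (act K)^[n] w x := by
  induction n generalizing x with
  | zero => exact h x
  | succ n ih => simp only [Function.iterate_succ_apply']; exact act_mono ih x

lemma act_add (v w : S → ℝ≥0∞) (x : S) :
    act K (fun z => v z + w z) x = act K v x + act K w x := by
  simp only [act, mul_add, ENNReal.tsum_add]

lemma act_const_mul (c : ℝ≥0∞) (v : S → ℝ≥0∞) (x : S) :
    act K (fun z => c * v z) x = c * act K v x := by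
  simp only [act, ← ENNReal.tsum_mul_left]
  exact tsum_congr fun z => by ring

lemma act_tsum (v : ℕ → S → ℝ≥0∞) (x : S) :
    act K (fun z => ∑' n, v n z) x = ∑' n, act K (v n) x := by
  simp only [act, ← ENNReal.tsum_mul_left]
  exact ENNReal.tsum_comm

lemma iterate_act_linear (a b : ℝ≥0∞) (v w : S → ℝ≥0∞) (n : ℕ) (x : S) :
    (act K)^[n] (fun z => a * v z + b * w z) x
      = a * (act K)^[n] v x + b * (act K)^[n] w x := by
  induction n generalizing x with
  | zero => rfl
  | succ n ih =>
    simp only [Function.iterate_succ_apply']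
    rw [← act_const_mul, ← act_const_mul, ← act_add]
    exact congrArg (fun q => act K q x) (funext ih)

lemma pot_eq (K : S → S → ℝ≥0∞) (v : S → ℝ≥0∞) (x : S) :
    pot K v x = v x + act K (pot K v) x := by
  have : act K (pot K v) x = ∑' n, act K ((act K)^[n] v) x := act_tsum _ x
  rw [this, pot, tsum_eq_zero_add' ENNReal.summable]
  simp only [Function.iterate_succ_apply', Function.iterate_zero, id]

lemma iterate_act_pot (n : ℕ) (x : S) :
    (act K)^[n] (pot K v) x = ∑' m, (act K)^[m + n] v x := by
  induction n generalizing x with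
  | zero => rfl
  | succ n ih =>
    rw [Function.iterate_succ_apply']
    have : act K ((act K)^[n] (pot K v)) x = act K (fun z => ∑' m, (act K)^[m + n] v z) x :=
      congrArg (fun q => act K q x) (funext ih)
    rw [this, act_tsum]
    refine tsum_congr fun m => ?_
    rw [← add_assoc, Function.iterate_succ_apply']

/-- Minimality of the potential among the excessive functions. -/
lemma pot_le_of_partial (h : ∀ n x, (∑ m ∈ Finset.range n, (act K)^[m] v x) ≤ w x) (x : S) :
    pot K v x ≤ w x := by
  rw [pot, ENNReal.tsum_eq_iSup_nat]
  exact iSup_le fun n => h n x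

lemma sum_iterate_succ (n : ℕ) (x : S) :
    (∑ m ∈ Finset.range (n + 1), (act K)^[m] v x)
      = v x + act K (fun z => ∑ m ∈ Finset.range n, (act K)^[m] v z) x := by
  have key : act K (fun z => ∑ m ∈ Finset.range n, (act K)^[m] v z) x
      = ∑ m ∈ Finset.range n, (act K)^[m + 1] v x := by
    induction n with
    | zero => simp [act]
    | succ n ih =>
      simp only [Finset.sum_range_succ]
      rw [act_add, ih, Function.iterate_succ_apply']
  rw [Finset.sum_range_succ', key, add_comm]
  rfl

lemma pot_le (h : ∀ x, v x + act K w x ≤ w x) (x : S) : pot K v x ≤ w x := by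
  refine pot_le_of_partial (fun n => ?_) x
  induction n with
  | zero => simp
  | succ n ih =>
    intro x
    rw [sum_iterate_succ]
    exact (add_le_add le_rfl (act_mono ih x)).trans (h x)

lemma pot_mono_fun (h : ∀ z, v z ≤ w z) (x : S) : pot K v x ≤ pot K w x :=
  ENNReal.tsum_le_tsum fun n => iterate_act_mono h n x

lemma pot_mono_kernel {K' : S → S → ℝ≥0∞} (h : ∀ x z, K x z ≤ K' x z) (x : S) :
    pot K v x ≤ pot K' v x := by
  refine pot_le (fun x => ?_) x
  conv_rhs => rw [pot_eq]
  gcongr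
  exact ENNReal.tsum_le_tsum fun z => by gcongr; exact h x z

/-- Subharmonicity iterates to w ≤ Kⁿ w. Applied to the bound, Kⁿ gives a times a term and b times a
tail of the convergent series ∑ Kᵐ 1. -/
lemma eq_zero_of_le_act (hu : ∀ x, pot K 1 x ≠ ⊤) {a b : ℝ≥0∞} (ha : a ≠ ⊤) (hb : b ≠ ⊤)
    (hw : ∀ x, w x ≤ act K w x) (hbound : ∀ x, w x ≤ a + b * pot K 1 x) (x : S) : w x = 0 := by
  have h1 : ∀ n x, w x ≤ (act K)^[n] w x := by
    intro n
    induction n with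
    | zero => intro x; rfl
    | succ n ih =>
      intro x
      rw [Function.iterate_succ_apply']
      exact (hw x).trans (act_mono ih x)
  have h2 : ∀ n, w x ≤ a * (act K)^[n] 1 x + b * ∑' m, (act K)^[m + n] 1 x := by
    intro n
    rw [← iterate_act_pot, ← iterate_act_linear]
    refine (h1 n x).trans (iterate_act_mono (fun z => ?_) n x)
    simpa using hbound z
  have t1 : Tendsto (fun n => (act K)^[n] 1 x) atTop (𝓝 0) :=
    ENNReal.tendsto_atTop_zero_of_tsum_ne_top (hu x)
  have t2 : Tendsto (fun n => ∑' m, (act K)^[m + n] 1 x) atTop (𝓝 0) :=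
    ENNReal.tendsto_sum_nat_add _ (hu x)
  have t3 : Tendsto (fun n => a * (act K)^[n] 1 x + b * ∑' m, (act K)^[m + n] 1 x) atTop
      (𝓝 (a * 0 + b * 0)) :=
    (ENNReal.Tendsto.const_mul t1 (Or.inr ha)).add (ENNReal.Tendsto.const_mul t2 (Or.inr hb))
  simp only [mul_zero, add_zero] at t3
  exact le_antisymm (ge_of_tendsto' t3 h2) zero_le

end Kernel

/-! ### The functionals of a Markov chain as potentials -/

section Chain

variable {S : Type*}

/-- The full kernel of a real matrix. -/
def full (P : Matrix S S ℝ) (x z : S) : ℝ≥0∞ := ENNReal.ofReal (P x z)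

open Classical in
/-- The kernel of a real matrix with the transitions into `C` removed. -/
def taboo (P : Matrix S S ℝ) (C : Set S) (x z : S) : ℝ≥0∞ :=
  if z ∈ C then 0 else ENNReal.ofReal (P x z)

open Classical in
lemma act_taboo (P : Matrix S S ℝ) (C : Set S) (v : S → ℝ≥0∞) (x : S) :
    act (taboo P C) v x = act (full P) (fun z => if z ∈ C then 0 else v z) x := by
  refine tsum_congr fun z => ?_
  by_cases h : z ∈ C <;> simp [taboo, full, h]

lemma taboo_anti (P : Matrix S S ℝ) {C C' : Set S} (h : C' ⊆ C) (x z : S) :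
    taboo P C x z ≤ taboo P C' x z := by
  unfold taboo
  split_ifs with h1 h2 h2
  · rfl
  · exact zero_le
  · exact absurd (h h2) h1
  · rfl

lemma IsStochastic.act_full_one {P : Matrix S S ℝ} (hP : IsStochastic P) (x : S) :
    act (full P) 1 x = 1 := by
  have := hP.2 x
  simp only [act, full, Pi.one_apply, mul_one]
  rw [← ENNReal.ofReal_tsum_of_nonneg (hP.1 x) this.summable, this.tsum_eq, ENNReal.ofReal_one]

variable {Ω : Type*} [MeasurableSpace Ω] {P : Matrix S S ℝ} {ℙ : S → Measure Ω} {Z : ℕ → Ω → S}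

/-- No visit to `C` during the times `1, …, n`, and state `z` at time `n`. -/
def avoid (Z : ℕ → Ω → S) (C : Set S) (n : ℕ) (z : S) : Set Ω :=
  {ω | Z n ω = z ∧ ∀ m, 1 ≤ m → m ≤ n → Z m ω ∉ C}

omit [MeasurableSpace Ω] in
lemma lt_hitTime_iff (C : Set S) (ω : Ω) (n : ℕ) :
    (n : ℕ∞) < hitTime Z C ω ↔ ∀ m, 1 ≤ m → m ≤ n → Z m ω ∉ C := by
  unfold hitTime
  constructor
  · intro h m h1 h2 h3
    have : (⨅ (n : ℕ) (_ : 1 ≤ n ∧ Z n ω ∈ C), (n : ℕ∞)) ≤ m := iInf₂_le m ⟨h1, h3⟩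
    have h4 := h.trans_le this
    exact absurd h2 (not_le.mpr (by exact_mod_cast h4))
  · intro h
    have : ((n + 1 : ℕ) : ℕ∞) ≤ ⨅ (n : ℕ) (_ : 1 ≤ n ∧ Z n ω ∈ C), (n : ℕ∞) := by
      refine le_iInf₂ fun m hm => ?_
      have : n < m := by
        by_contra hc
        exact h m hm.1 (not_lt.mp hc) hm.2
      exact_mod_cast this
    refine lt_of_lt_of_le ?_ this
    exact_mod_cast Nat.lt_succ_self n

omit [MeasurableSpace Ω] in
lemma hitTime_eq_succ_iff (C : Set S) (ω : Ω) (n : ℕ) :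
    hitTime Z C ω = (n + 1 : ℕ) ↔
      (∀ m, 1 ≤ m → m ≤ n → Z m ω ∉ C) ∧ Z (n + 1) ω ∈ C := by
  have h1 := lt_hitTime_iff (Z := Z) C ω n
  have h2 := lt_hitTime_iff (Z := Z) C ω (n + 1)
  rw [← h1]
  constructor
  · intro h
    refine ⟨by rw [h]; exact_mod_cast Nat.lt_succ_self n, ?_⟩
    by_contra hc
    have h3 : ((n + 1 : ℕ) : ℕ∞) < hitTime Z C ω := by
      rw [h2]
      intro m hm1 hm2
      rcases hm2.eq_or_lt with rfl | h5
      · exact hc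
      · exact (h1.mp (by rw [h]; exact_mod_cast Nat.lt_succ_self n)) m hm1 (by omega)
    exact absurd h (ne_of_gt h3)
  · rintro ⟨h, hc⟩
    refine le_antisymm (iInf₂_le (n + 1) ⟨by omega, hc⟩) ?_
    have := Order.add_one_le_of_lt h
    exact_mod_cast this

omit [MeasurableSpace Ω] in
lemma one_le_hitTime (C : Set S) (ω : Ω) : 1 ≤ hitTime Z C ω :=
  le_iInf₂ fun m hm => by exact_mod_cast hm.1

namespace IsMarkovChain

variable [Countable S] (hZ : IsMarkovChain P ℙ Z)

include hZ

lemma measurableSet_mem (n : ℕ) (C : Set S) : MeasurableSet {ω | Z n ω ∈ C} := by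
  have : {ω | Z n ω ∈ C} = ⋃ c ∈ C, {ω | Z n ω = c} := by ext; simp
  rw [this]
  exact MeasurableSet.biUnion C.to_countable fun c _ => hZ.meas n c

omit [Countable S] in
lemma measurableSet_path (n : ℕ) (z : ℕ → S) : MeasurableSet {ω | ∀ m ≤ n, Z m ω = z m} := by
  have : {ω | ∀ m ≤ n, Z m ω = z m} = ⋂ m ∈ Set.Iic n, {ω | Z m ω = z m} := by ext; simp
  rw [this]
  exact MeasurableSet.biInter (Set.to_countable _) fun m _ => hZ.meas m _

lemma measurableSet_avoid (C : Set S) (n : ℕ) (z : S) : MeasurableSet (avoid Z C n z) := by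
  have : avoid Z C n z
      = {ω | Z n ω = z} ∩ ⋂ m ∈ Set.Icc 1 n, {ω | Z m ω ∈ Cᶜ} := by
    ext; simp [avoid]
  rw [this]
  exact (hZ.meas n z).inter
    (MeasurableSet.biInter (Set.to_countable _) fun m _ => hZ.measurableSet_mem m _)

/-- The Markov property for events determined by the path up to time `n`. -/
lemma measure_avoid_inter (C : Set S) (n : ℕ) (x z y : S) :
    ℙ x (avoid Z C n z ∩ {ω | Z (n + 1) ω = y}) = ℙ x (avoid Z C n z) * full P z y := by
  classical
  -- Pads a path of length n by a constant. With the constant y, the same sequence describes the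
  -- cylinders at time n and at time n + 1, so `step` applies to each path.
  let ext : (Fin (n + 1) → S) → S → ℕ → S := fun q c m => if h : m < n + 1 then q ⟨m, h⟩ else c
  let T : Set (Fin (n + 1) → S) :=
    {q | q (Fin.last n) = z ∧ ∀ m : Fin (n + 1), 1 ≤ (m : ℕ) → q m ∉ C}
  have hext : ∀ q c (ω : Ω), (∀ m ≤ n, Z m ω = ext q c m) ↔ ∀ m : Fin (n + 1), Z m ω = q m := by
    intro q c ω
    constructor
    · intro h m
      have := h m (by omega)
      simpa only [ext, dif_pos m.2] using this
    · intro h m hm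
      simpa only [ext, dif_pos (Nat.lt_succ_of_le hm)] using h ⟨m, Nat.lt_succ_of_le hm⟩
  have hA : avoid Z C n z = ⋃ q : T, {ω | ∀ m ≤ n, Z m ω = ext q.1 y m} := by
    ext ω
    simp only [Set.mem_iUnion, Set.mem_ofPred_eq, hext]
    constructor
    · rintro ⟨h1, h2⟩
      exact ⟨⟨fun m => Z m ω, by simpa using h1,
        fun m hm => h2 m hm (by omega)⟩, fun m => rfl⟩
    · rintro ⟨⟨q, hq1, hq2⟩, h⟩
      refine ⟨(h (Fin.last n)).trans hq1, fun m h1 h2 => ?_⟩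
      have := h ⟨m, by omega⟩
      simp only at this
      rw [this]
      exact hq2 _ h1
  have hB : avoid Z C n z ∩ {ω | Z (n + 1) ω = y}
      = ⋃ q : T, {ω | ∀ m ≤ n + 1, Z m ω = ext q.1 y m} := by
    rw [hA, Set.iUnion_inter]
    refine Set.iUnion_congr fun q => ?_
    ext ω
    simp only [Set.mem_inter_iff, Set.mem_ofPred_eq]
    constructor
    · rintro ⟨h1, h2⟩ m hm
      rcases hm.eq_or_lt with rfl | h
      · simpa [ext] using h2
      · exact h1 m (by omega)
    · intro h
      refine ⟨fun m hm => h m (by omega), ?_⟩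
      simpa [ext] using h (n + 1) le_rfl
  have hdisj : Pairwise (Function.onFun Disjoint
      fun q : T => {ω | ∀ m ≤ n, Z m ω = ext q.1 y m}) := by
    intro q q' hne
    refine Set.disjoint_left.mpr fun ω h h' => hne ?_
    simp only [Set.mem_ofPred_eq, hext] at h h'
    exact Subtype.ext (funext fun m => (h m).symm.trans (h' m))
  have hdisj' : Pairwise (Function.onFun Disjoint
      fun q : T => {ω | ∀ m ≤ n + 1, Z m ω = ext q.1 y m}) := by
    intro q q' hne
    have hsub : ∀ q : T, {ω | ∀ m ≤ n + 1, Z m ω = ext q.1 y m}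
        ⊆ {ω | ∀ m ≤ n, Z m ω = ext q.1 y m} := fun q ω h m hm => h m (hm.trans n.le_succ)
    exact (hdisj hne).mono (hsub q) (hsub q')
  rw [hB, hA, measure_iUnion hdisj' fun q => hZ.measurableSet_path _ _,
    measure_iUnion hdisj fun q => hZ.measurableSet_path _ _, ← ENNReal.tsum_mul_right]
  refine tsum_congr fun q => ?_
  rw [hZ.step]
  have e1 : ext q.1 y n = z := by
    have := q.2.1
    simpa [ext, Fin.last] using this
  have e2 : ext q.1 y (n + 1) = y := by simp [ext]
  rw [e1, e2, full]

/-- Testing against an arbitrary f makes the induction work: the last step is absorbed into f. -/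
lemma tsum_measure_avoid (C : Set S) (n : ℕ) (x : S) (f : S → ℝ≥0∞) :
    ∑' z, ℙ x (avoid Z C n z) * f z = (act (taboo P C))^[n] f x := by
  classical
  induction n generalizing f with
  | zero =>
    have h0 : ∀ z, ℙ x (avoid Z C 0 z) = if z = x then 1 else 0 := by
      intro z
      have hx := hZ.start x
      have : avoid Z C 0 z = {ω | Z 0 ω = z} := by
        ext ω
        simp only [avoid, Set.mem_ofPred_eq, and_iff_left_iff_imp]
        intro _ m h1 h2
        omega
      rw [this]
      split_ifs with h
      · rw [h, hx]
      · have := hZ.prob x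
        have h1 := prob_compl_eq_one_sub (μ := ℙ x) (hZ.meas 0 x)
        rw [hx, tsub_self] at h1
        refine measure_mono_null (fun ω hω => ?_) h1
        simp only [Set.mem_compl_iff, Set.mem_ofPred_eq] at hω ⊢
        rw [hω]
        exact h
    simp only [h0, Function.iterate_zero, id]
    rw [tsum_eq_single x (fun z hz => by simp [hz])]
    simp
  | succ n ih =>
    have hs : ∀ y, ℙ x (avoid Z C (n + 1) y)
        = ∑' z, ℙ x (avoid Z C n z) * taboo P C z y := by
      intro y
      by_cases hy : y ∈ C
      · have : avoid Z C (n + 1) y = ∅ := by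
          ext ω
          simp only [avoid, Set.mem_ofPred_eq, Set.mem_empty_iff_false, iff_false, not_and]
          intro h1 h2
          exact h2 (n + 1) (by omega) le_rfl (h1 ▸ hy)
        simp [this, taboo, hy]
      · have : avoid Z C (n + 1) y = ⋃ z, avoid Z C n z ∩ {ω | Z (n + 1) ω = y} := by
          ext ω
          simp only [avoid, Set.mem_ofPred_eq, Set.mem_iUnion, Set.mem_inter_iff]
          constructor
          · rintro ⟨h1, h2⟩
            exact ⟨Z n ω, ⟨rfl, fun m hm1 hm2 => h2 m hm1 (by omega)⟩, h1⟩
          · rintro ⟨z, ⟨_, h2⟩, h1⟩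
            refine ⟨h1, fun m hm1 hm2 => ?_⟩
            rcases hm2.eq_or_lt with rfl | h
            · rw [h1]; exact hy
            · exact h2 m hm1 (by omega)
        rw [this, measure_iUnion]
        · refine tsum_congr fun z => ?_
          rw [hZ.measure_avoid_inter]
          simp [taboo, hy, full]
        · intro z z' hne
          refine Set.disjoint_left.mpr fun ω h h' => hne ?_
          exact h.1.1.symm.trans h'.1.1
        · exact fun z => (hZ.measurableSet_avoid C n z).inter (hZ.meas _ _)
    rw [Function.iterate_succ_apply, ← ih]
    simp only [hs, act, ← ENNReal.tsum_mul_right, ← ENNReal.tsum_mul_left]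
    rw [ENNReal.tsum_comm]
    simp only [mul_assoc]

lemma measure_avoid (C : Set S) (n : ℕ) (x y : S) [DecidableEq S] :
    ℙ x (avoid Z C n y) = (act (taboo P C))^[n] (Pi.single y 1) x := by
  rw [← hZ.tsum_measure_avoid, tsum_eq_single y]
  · simp
  · intro z hz
    simp [hz]

lemma meanVisits_eq [DecidableEq S] (C : Set S) (x y : S) :
    meanVisits ℙ Z C x y = pot (taboo P C) (Pi.single y 1) x := by
  classical
  have h : ∀ (n : ℕ) (ω : Ω), (if (n : ℕ∞) < hitTime Z C ω ∧ Z n ω = y then (1 : ℝ≥0∞) else 0)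
      = (avoid Z C n y).indicator 1 ω := by
    intro n ω
    rw [Set.indicator_apply]
    refine if_congr ?_ rfl rfl
    rw [lt_hitTime_iff, and_comm]
    rfl
  unfold meanVisits pot
  rw [lintegral_tsum]
  · refine tsum_congr fun n => ?_
    rw [← hZ.measure_avoid, ← lintegral_indicator_one (hZ.measurableSet_avoid C n y)]
    refine lintegral_congr fun ω => ?_
    rw [← h]
    congr
  · intro n
    have : (fun ω => (if (n : ℕ∞) < hitTime Z C ω ∧ Z n ω = y then (1 : ℝ≥0∞) else 0))
      = (avoid Z C n y).indicator 1 := funext (h n)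
    convert (measurable_one.indicator (hZ.measurableSet_avoid C n y)).aemeasurable using 1
    rw [← this]
    funext ω
    congr

lemma meanHit_eq (C : Set S) (x : S) : meanHit ℙ Z C x = pot (taboo P C) 1 x := by
  classical
  -- T_C is the sum over n of the indicators of n < T_C, each split according to the state at time
  -- n.
  have h : ∀ ω, (hitTime Z C ω : ℝ≥0∞) = ∑' n : ℕ, ∑' y, (avoid Z C n y).indicator 1 ω := by
    intro ω
    have h1 : ∀ n : ℕ, (∑' y, (avoid Z C n y).indicator (1 : Ω → ℝ≥0∞) ω)
        = if (n : ℕ∞) < hitTime Z C ω then 1 else 0 := by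
      intro n
      rw [tsum_eq_single (Z n ω)]
      · rw [Set.indicator_apply]
        refine if_congr ?_ rfl rfl
        rw [lt_hitTime_iff]
        simp [avoid]
      · intro y hy
        rw [Set.indicator_of_notMem]
        exact fun hmem => hy hmem.1.symm
    simp only [h1]
    generalize hitTime Z C ω = t
    induction t using ENat.recTopCoe with
    | top => simp
    | coe k =>
      rw [tsum_eq_sum (s := Finset.range k)]
      · rw [Finset.sum_congr rfl (g := fun _ => (1 : ℝ≥0∞))]
        · simp
        · intro n hn
          rw [if_pos]
          exact_mod_cast Finset.mem_range.mp hn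
      · intro n hn
        rw [if_neg]
        rw [Finset.mem_range] at hn
        exact_mod_cast hn
  unfold meanHit
  simp only [h]
  have hm : ∀ n y, Measurable ((avoid Z C n y).indicator (1 : Ω → ℝ≥0∞)) := fun n y =>
    measurable_one.indicator (hZ.measurableSet_avoid C n y)
  rw [lintegral_tsum fun n => (Measurable.tsum (hm n)).aemeasurable]
  refine tsum_congr fun n => ?_
  rw [lintegral_tsum fun y => (hm n y).aemeasurable, ← hZ.tsum_measure_avoid]
  refine tsum_congr fun y => ?_
  rw [lintegral_indicator_one (hZ.measurableSet_avoid C n y), Pi.one_apply, mul_one]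

/-- The law of the chain at the first entry into `C`. -/
lemma measure_enter (C : Set S) (x c : S) (hc : c ∈ C) :
    ℙ x {ω | ∃ n : ℕ, hitTime Z C ω = n ∧ Z n ω = c}
      = pot (taboo P C) (fun z => full P z c) x := by
  have h : {ω | ∃ n : ℕ, hitTime Z C ω = n ∧ Z n ω = c}
      = ⋃ n : ℕ, ⋃ z, avoid Z C n z ∩ {ω | Z (n + 1) ω = c} := by
    ext ω
    simp only [Set.mem_ofPred_eq, Set.mem_iUnion]
    constructor
    · rintro ⟨n, h1, h2⟩
      obtain ⟨k, rfl⟩ : ∃ k, n = k + 1 := by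
        have := one_le_hitTime (Z := Z) C ω
        rw [h1] at this
        exact Nat.exists_eq_add_of_le' (by exact_mod_cast this)
      exact ⟨k, Z k ω, ⟨rfl, ((hitTime_eq_succ_iff C ω k).mp h1).1⟩, h2⟩
    · rintro ⟨n, z, ⟨_, h1⟩, h2⟩
      refine ⟨n + 1, (hitTime_eq_succ_iff C ω n).mpr ⟨h1, ?_⟩, h2⟩
      have h2' : Z (n + 1) ω = c := h2
      rw [h2']
      exact hc
  have hmeas : ∀ n z, MeasurableSet (avoid Z C n z ∩ {ω | Z (n + 1) ω = c}) := fun n z =>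
    (hZ.measurableSet_avoid C n z).inter (hZ.meas _ _)
  rw [h, measure_iUnion]
  · refine tsum_congr fun n => ?_
    rw [measure_iUnion]
    · rw [← hZ.tsum_measure_avoid]
      exact tsum_congr fun z => hZ.measure_avoid_inter C n x z c
    · intro z z' hne
      refine Set.disjoint_left.mpr fun ω h h' => hne ?_
      exact h.1.1.symm.trans h'.1.1
    · exact hmeas n
  · intro n n' hne
    refine Set.disjoint_left.mpr fun ω h h' => hne ?_
    have key : ∀ n, ω ∈ (⋃ z, avoid Z C n z ∩ {ω | Z (n + 1) ω = c}) →
        hitTime Z C ω = (n + 1 : ℕ) := by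
      intro n hn
      obtain ⟨z, h1, h2⟩ := Set.mem_iUnion.mp hn
      have h2' : Z (n + 1) ω = c := h2
      exact (hitTime_eq_succ_iff C ω n).mpr ⟨h1.2, h2' ▸ hc⟩
    have e := (key n h).symm.trans (key n' h')
    have : n + 1 = n' + 1 := by exact_mod_cast e
    omega
  · exact fun n => MeasurableSet.iUnion (hmeas n)

end IsMarkovChain

end Chain

lemma hasSum_of_eq {ι α : Type*} [AddCommMonoid α] [TopologicalSpace α] {f g : ι → α} {a b : α}
    (h : HasSum f a) (hf : ∀ i, f i = g i) (ha : a = b) : HasSum g b := by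
  rwa [← ha, ← funext hf]

/-! ### Positive recurrence and the Poisson equation -/

section Recurrence

lemma taboo_le_full {S : Type*} (P : Matrix S S ℝ) (C : Set S) (x z : S) :
    taboo P C x z ≤ full P x z := by
  simp only [taboo, full]
  split_ifs <;> simp

variable {S : Type*} {P : Matrix S S ℝ} {p : S → ℝ}

lemma IsStationary.pos (hP : IsStochastic P) (hirr : IsIrred P) (hp : IsStationary P p) (x : S) :
    0 < p x := by
  obtain ⟨x₀, hx₀⟩ : ∃ x₀, 0 < p x₀ := by
    by_contra! hc
    have h0 : p = fun _ => 0 := funext fun x => le_antisymm (hc x) (hp.nonneg x)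
    have := hp.total
    rw [h0] at this
    exact zero_ne_one (hasSum_zero.unique this)
  induction hirr x₀ x with
  | refl => exact hx₀
  | @tail b c _ h ih =>
    have := le_hasSum (hp.invariant c) b fun z _ => mul_nonneg (hp.nonneg z) (hP.1 z c)
    exact (mul_pos ih h).trans_le this

/-- Integration against a nonnegative vector. -/
def pair (p : S → ℝ) (f : S → ℝ≥0∞) : ℝ≥0∞ := ∑' x, ENNReal.ofReal (p x) * f x

lemma IsStationary.pair_one (hp : IsStationary P p) : pair p 1 = 1 := by
  simp only [pair, Pi.one_apply, mul_one]
  rw [← ENNReal.ofReal_tsum_of_nonneg hp.nonneg hp.total.summable, hp.total.tsum_eq,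
    ENNReal.ofReal_one]

/-- Forbidding s removes exactly the column s from p P = p. Iterating, the mass at s feeds the
successive terms of the potential at s. -/
lemma IsStationary.pair_act (hP : IsStochastic P) (hp : IsStationary P p) (s : S)
    (f : S → ℝ≥0∞) :
    pair p (act (taboo P {s}) f) + ENNReal.ofReal (p s) * f s = pair p f := by
  classical
  have hcol : ∀ z, ∑' x, ENNReal.ofReal (p x) * ENNReal.ofReal (P x z) = ENNReal.ofReal (p z) := by
    intro z
    rw [← (hp.invariant z).tsum_eq, ENNReal.ofReal_tsum_of_nonneg
      (fun x => mul_nonneg (hp.nonneg x) (hP.1 x z)) (hp.invariant z).summable]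
    exact tsum_congr fun x => (ENNReal.ofReal_mul (hp.nonneg x)).symm
  have h1 : pair p (act (taboo P {s}) f)
      = ∑' z, if z = s then 0 else ENNReal.ofReal (p z) * f z := by
    simp only [pair, act, ← ENNReal.tsum_mul_left]
    rw [ENNReal.tsum_comm]
    refine tsum_congr fun z => ?_
    by_cases hz : z = s
    · simp [taboo, hz]
    · simp only [taboo, Set.mem_singleton_iff, hz, if_false, ← mul_assoc]
      rw [ENNReal.tsum_mul_right, hcol]
  have h2 : ENNReal.ofReal (p s) * f s = ∑' z, if z = s then ENNReal.ofReal (p z) * f z else 0 := by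
    rw [tsum_eq_single s fun z hz => if_neg hz, if_pos rfl]
  rw [h1, h2, ← ENNReal.tsum_add, pair]
  refine tsum_congr fun z => ?_
  by_cases hz : z = s <;> simp [hz]

lemma IsStationary.pair_iterate (hP : IsStochastic P) (hp : IsStationary P p) (s : S)
    (f : S → ℝ≥0∞) (n : ℕ) :
    pair p ((act (taboo P {s}))^[n] f)
      + ENNReal.ofReal (p s) * ∑ m ∈ Finset.range n, (act (taboo P {s}))^[m] f s = pair p f := by
  induction n with
  | zero => simp
  | succ n ih =>
    rw [Finset.sum_range_succ, mul_add, Function.iterate_succ_apply', ← ih,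
      ← hp.pair_act hP s ((act (taboo P {s}))^[n] f)]
    ring

lemma IsStationary.pot_le (hP : IsStochastic P) (hp : IsStationary P p) (s : S)
    (f : S → ℝ≥0∞) :
    ENNReal.ofReal (p s) * pot (taboo P {s}) f s ≤ pair p f := by
  rw [pot, ENNReal.tsum_eq_iSup_nat, ENNReal.mul_iSup]
  refine iSup_le fun n => ?_
  rw [← hp.pair_iterate hP s f n]
  exact le_add_self

/-- Mean hitting times of points are finite. -/
lemma IsStationary.meanHit_finite (hP : IsStochastic P) (hirr : IsIrred P)
    (hp : IsStationary P p) (s x : S) : pot (taboo P {s}) 1 x ≠ ⊤ := by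
  classical
  induction hirr s x with
  | refl =>
    intro h
    have := hp.pot_le hP s 1
    rw [h, hp.pair_one, ENNReal.mul_top (by simpa using hp.pos hP hirr s)] at this
    simp at this
  | @tail b c _ h ih =>
    by_cases hc : c = s
    · subst hc
      intro h
      have := hp.pot_le hP c 1
      rw [h, hp.pair_one, ENNReal.mul_top (by simpa using hp.pos hP hirr c)] at this
      simp at this
    -- The transition from b to c has positive weight, so an infinite value at c would force one at
    -- b; finiteness travels along the path from s.
    · intro htop
      apply ih
      rw [pot_eq]
      have h1 : taboo P {s} b c * pot (taboo P {s}) 1 c ≤ act (taboo P {s}) (pot (taboo P {s}) 1) b :=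
        ENNReal.le_tsum c
      have h2 : taboo P {s} b c ≠ 0 := by simpa [taboo, hc] using h
      rw [htop, ENNReal.mul_top h2, top_le_iff] at h1
      rw [h1]
      simp

/-- The cycle formula for the stationary distribution. -/
lemma IsStationary.cycle (hP : IsStochastic P) (hirr : IsIrred P) (hp : IsStationary P p) (s : S)
    (f : S → ℝ≥0∞) (hf : ∀ x, f x ≤ 1) :
    ENNReal.ofReal (p s) * pot (taboo P {s}) f s = pair p f := by
  -- The remainder in `pair_iterate` vanishes by dominated convergence: p dominates, and Kⁿ f ≤ Kⁿ 1
  -- is bounded by the terms of a convergent series.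
  have hlim : Tendsto (fun n => pair p ((act (taboo P {s}))^[n] f)) atTop (𝓝 0) := by
    let _ : MeasurableSpace S := ⊤
    have hone : ∀ n x, (act (taboo P {s}))^[n] f x ≤ 1 := by
      intro n
      induction n with
      | zero => exact hf
      | succ n ih =>
        intro x
        rw [Function.iterate_succ_apply']
        refine (act_mono (w := 1) ih x).trans ((ENNReal.tsum_le_tsum fun z => ?_).trans_eq
          (hP.act_full_one x))
        exact mul_le_mul_left (taboo_le_full P {s} x z) _
    have := tendsto_lintegral_of_dominated_convergence (μ := Measure.count)
      (F := fun n x => ENNReal.ofReal (p x) * (act (taboo P {s}))^[n] f x) (f := fun _ => 0)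
      (fun x => ENNReal.ofReal (p x)) (fun n => measurable_from_top)
      (fun n => Eventually.of_forall fun x => by
        calc _ ≤ ENNReal.ofReal (p x) * 1 := mul_le_mul' le_rfl (hone n x)
          _ = _ := mul_one _)
      (by
        rw [lintegral_count]
        have := hp.pair_one
        simp only [pair, Pi.one_apply, mul_one] at this
        simp [this])
      (Eventually.of_forall fun x => by
        have h1 : Tendsto (fun n => (act (taboo P {s}))^[n] 1 x) atTop (𝓝 0) :=
          ENNReal.tendsto_atTop_zero_of_tsum_ne_top (hp.meanHit_finite hP hirr s x)
        have h2 : Tendsto (fun n => (act (taboo P {s}))^[n] f x) atTop (𝓝 0) :=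
          tendsto_of_tendsto_of_tendsto_of_le_of_le tendsto_const_nhds h1 (fun _ => zero_le)
            fun n => iterate_act_mono (fun z => by simpa using hf z) n x
        simpa using ENNReal.Tendsto.const_mul h2 (Or.inr ENNReal.ofReal_ne_top))
    simpa [lintegral_count, pair] using this
  have h1 : Tendsto (fun n => pair p ((act (taboo P {s}))^[n] f) + ENNReal.ofReal (p s) *
      ∑ m ∈ Finset.range n, (act (taboo P {s}))^[m] f s) atTop
      (𝓝 (0 + ENNReal.ofReal (p s) * pot (taboo P {s}) f s)) :=
    hlim.add (ENNReal.Tendsto.const_mul (ENNReal.tendsto_nat_tsum _) (Or.inr ENNReal.ofReal_ne_top))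
  simp only [hp.pair_iterate hP s f, zero_add] at h1
  exact tendsto_nhds_unique h1 tendsto_const_nhds

lemma hasSum_of_act {P : Matrix S S ℝ} (hP : ∀ x z, 0 ≤ P x z) {v : S → ℝ≥0∞} {x : S}
    (hv : ∀ z, v z ≠ ⊤) (ha : act (full P) v x ≠ ⊤) :
    HasSum (fun z => P x z * (v z).toReal) (act (full P) v x).toReal := by
  have h : ∀ z, full P x z * v z ≠ ⊤ := fun z => ENNReal.mul_ne_top ENNReal.ofReal_ne_top (hv z)
  have := ENNReal.hasSum_toReal ha
  rw [act, ENNReal.tsum_toReal_eq h]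
  convert this using 2 with z
  simp [full, ENNReal.toReal_mul, ENNReal.toReal_ofReal (hP x z)]

lemma act_taboo_singleton (s x : S) (v : S → ℝ≥0∞) :
    act (taboo P {s}) v x + full P x s * v s = act (full P) v x := by
  classical
  have h2 : full P x s * v s = ∑' z, if z = s then full P x z * v z else 0 := by
    rw [tsum_eq_single s fun z hz => if_neg hz, if_pos rfl]
  rw [h2, act, act, ← ENNReal.tsum_add]
  refine tsum_congr fun z => ?_
  by_cases hz : z = s <;> simp [taboo, full, hz]

/-- Restoring the forbidden column s in K V = V - v costs the term P(x,s) V(s). -/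
lemma hasSum_pot_singleton (hP : IsStochastic P) {v : S → ℝ≥0∞} {s : S}
    (hv : ∀ x, v x ≠ ⊤) (hpot : ∀ x, pot (taboo P {s}) v x ≠ ⊤) (x : S) :
    HasSum (fun z => P x z * (pot (taboo P {s}) v z).toReal)
      ((pot (taboo P {s}) v x).toReal - (v x).toReal
        + P x s * (pot (taboo P {s}) v s).toReal) := by
  have e := pot_eq (taboo P {s}) v x
  have hfin : act (taboo P {s}) (pot (taboo P {s}) v) x ≠ ⊤ := by
    intro h
    rw [h, add_top] at e
    exact hpot x e
  have h1 := act_taboo_singleton (P := P) s x (pot (taboo P {s}) v)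
  have h2 : full P x s * pot (taboo P {s}) v s ≠ ⊤ :=
    ENNReal.mul_ne_top ENNReal.ofReal_ne_top (hpot s)
  have h3 : act (full P) (pot (taboo P {s}) v) x ≠ ⊤ := by
    rw [← h1]
    exact ENNReal.add_ne_top.mpr ⟨hfin, h2⟩
  have := hasSum_of_act hP.1 hpot h3
  refine hasSum_of_eq this (fun _ => rfl) ?_
  rw [← h1, ENNReal.toReal_add hfin h2, e, ENNReal.toReal_add (hv x) hfin, ENNReal.toReal_mul,
    full, ENNReal.toReal_ofReal (hP.1 x s)]
  ring

lemma pot_single_le (C : Set S) [DecidableEq S] (x y : S) :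
    pot (taboo P C) (Pi.single y 1) x ≤ pot (taboo P C) 1 x :=
  pot_mono_fun (fun z => by
    by_cases h : z = y
    · subst h; simp
    · simp [h]) x

/-- The matrix `H` solves the Poisson equation. -/
lemma IsStationary.poisson [DecidableEq S] (hP : IsStochastic P) (hirr : IsIrred P)
    (hp : IsStationary P p) (s y x : S) :
    HasSum (fun z => P x z * ((pot (taboo P {s}) (Pi.single y 1) z).toReal
        - p y * (pot (taboo P {s}) 1 z).toReal))
      ((pot (taboo P {s}) (Pi.single y 1) x).toReal - p y * (pot (taboo P {s}) 1 x).toReal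
        - (Pi.single y 1 : S → ℝ) x + p y) := by
  have hh := hp.meanHit_finite hP hirr s
  have hV : ∀ x, pot (taboo P {s}) (Pi.single y 1) x ≠ ⊤ := fun x =>
    ne_top_of_le_ne_top (hh x) (pot_single_le {s} x y)
  have hs1 : ∀ z, (Pi.single y 1 : S → ℝ≥0∞) z = if z = y then 1 else 0 := fun z => by
    simp [Pi.single_apply]
  have h1 := hasSum_pot_singleton hP (v := Pi.single y 1) (s := s)
    (fun z => by rw [hs1]; split_ifs <;> simp) hV x
  have h2 := hasSum_pot_singleton hP (v := 1) (s := s) (fun z => by simp) hh x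
  have c1 := hp.cycle hP hirr s (Pi.single y 1) (fun z => by rw [hs1]; split_ifs <;> simp)
  have c2 := hp.cycle hP hirr s 1 (fun z => le_rfl)
  rw [hp.pair_one] at c2
  have c3 : pair p (Pi.single y 1) = ENNReal.ofReal (p y) := by
    rw [pair, tsum_eq_single y]
    · simp
    · intro z hz; simp [hz]
  rw [c3] at c1
  have r1 := congrArg ENNReal.toReal c1
  have r2 := congrArg ENNReal.toReal c2
  rw [ENNReal.toReal_mul, ENNReal.toReal_ofReal (hp.nonneg s),
    ENNReal.toReal_ofReal (hp.nonneg y)] at r1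
  rw [ENNReal.toReal_mul, ENNReal.toReal_ofReal (hp.nonneg s), ENNReal.toReal_one] at r2
  have hps := hp.pos hP hirr s
  -- The cycle formula for 1_y and for 1: at s the two potentials are in ratio p(y), so the extra
  -- terms P(x,s) V(s) cancel.
  have key : (pot (taboo P {s}) (Pi.single y 1) s).toReal
      = p y * (pot (taboo P {s}) 1 s).toReal := by
    apply mul_left_cancel₀ hps.ne'
    rw [r1]
    linear_combination -(p y) * r2
  have e := h1.sub (h2.mul_left (p y))
  refine hasSum_of_eq e (fun z => by ring) ?_
  · have : ((Pi.single y 1 : S → ℝ≥0∞) x).toReal = (Pi.single y 1 : S → ℝ) x := by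
      rw [hs1, Pi.single_apply]; split_ifs <;> simp
    rw [this, key]
    simp only [Pi.one_apply, ENNReal.toReal_one]
    ring

/-- Hitting a point takes no longer than hitting a set and then the point. -/
lemma pot_singleton_le (hP : IsStochastic P) (s : S) (C : Set S) (κ : ℝ≥0∞)
    (hκ : ∀ c ∈ C, pot (taboo P {s}) 1 c ≤ κ) (x : S) :
    pot (taboo P {s}) 1 x ≤ pot (taboo P C) 1 x + κ := by
  classical
  refine pot_le_of_partial (w := fun x => pot (taboo P C) 1 x + κ) (fun n => ?_) x
  induction n with
  | zero => simp
  | succ n ih =>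
    intro x
    have hpart : ∀ z, (∑ m ∈ Finset.range n, (act (taboo P {s}))^[m] 1 z)
        ≤ pot (taboo P {s}) 1 z := fun z => ENNReal.sum_le_tsum _
    rw [sum_iterate_succ]
    conv_rhs => rw [pot_eq, add_assoc]
    gcongr
    -- On C the hitting time of s is at most κ; off C the induction hypothesis applies. Since the
    -- rows of P sum to one, κ passes through unchanged.
    calc act (taboo P {s}) (fun z => ∑ m ∈ Finset.range n, (act (taboo P {s}))^[m] 1 z) x
        ≤ act (full P) (fun z => (if z ∈ C then 0 else pot (taboo P C) 1 z) + κ * 1) x := by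
          refine ENNReal.tsum_le_tsum fun z => ?_
          gcongr
          · exact taboo_le_full P {s} x z
          · simp only
            split_ifs with h
            · simpa using (hpart z).trans (hκ z h)
            · simpa using ih z
      _ = act (taboo P C) (pot (taboo P C) 1) x + κ := by
          rw [act_add, act_taboo, act_const_mul]
          have := hP.act_full_one x
          simp only [Pi.one_def] at this
          rw [this, mul_one]

end Recurrence

/-! ### Stationary distributions and functions with bounded increments -/

section Increments

variable {S : Type*} {R : Matrix S S ℝ} {q : S → ℝ}

/-- A function with bounded increments has zero mean increment under a stationary distribution. -/
lemma IsStationary.hasSum_increment (hR : IsStochastic R) (hq : IsStationary R q) {f : S → ℝ}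
    {M : ℝ} (hf : ∀ x z, R x z ≠ 0 → |f z - f x| ≤ M) :
    HasSum (fun x => q x * ∑' z, R x z * (f z - f x)) 0 := by
  have hqR : ∀ x z, 0 ≤ q x * R x z := fun x z => mul_nonneg (hq.nonneg x) (hR.1 x z)
  have hS : Summable fun a : S × S => q a.1 * R a.1 a.2 := by
    rw [summable_prod_of_nonneg fun a => hqR a.1 a.2]
    refine ⟨fun x => ((hR.2 x).mul_left (q x)).summable, ?_⟩
    have : ∀ x, ∑' z, q x * R x z = q x := fun x => by
      rw [tsum_mul_left, (hR.2 x).tsum_eq, mul_one]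
    simpa only [this] using hq.total.summable
  -- For bounded u the double sums of u at the two ends of a jump converge separately, and agree by
  -- invariance.
  have hbd : ∀ u : S → ℝ, (∃ c, ∀ x, |u x| ≤ c) →
      ∑' a : S × S, q a.1 * R a.1 a.2 * (u a.2 - u a.1) = 0 := by
    rintro u ⟨c, hc⟩
    have s1 : Summable fun a : S × S => q a.1 * R a.1 a.2 * u a.1 := by
      refine Summable.of_norm_bounded (hS.mul_right c) fun a => ?_
      rw [norm_mul, Real.norm_of_nonneg (hqR a.1 a.2)]
      exact mul_le_mul_of_nonneg_left (hc _) (hqR _ _)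
    have s2 : Summable fun a : S × S => q a.1 * R a.1 a.2 * u a.2 := by
      refine Summable.of_norm_bounded (hS.mul_right c) fun a => ?_
      rw [norm_mul, Real.norm_of_nonneg (hqR a.1 a.2)]
      exact mul_le_mul_of_nonneg_left (hc _) (hqR _ _)
    have t1 : ∑' a : S × S, q a.1 * R a.1 a.2 * u a.1 = ∑' x, q x * u x := by
      rw [s1.tsum_prod]
      refine tsum_congr fun x => ?_
      have : HasSum (fun z => q x * R x z * u x) (q x * u x) := by
        exact hasSum_of_eq ((hR.2 x).mul_left (q x * u x)) (fun z => by ring) (mul_one _)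
      exact this.tsum_eq
    have t2 : ∑' a : S × S, q a.1 * R a.1 a.2 * u a.2 = ∑' x, q x * u x := by
      rw [← (Equiv.prodComm S S).tsum_eq]
      have s3 := (Equiv.prodComm S S).summable_iff.mpr s2
      have := Summable.tsum_prod s3
      simp only [Function.comp_def, Equiv.prodComm_apply, Prod.fst_swap, Prod.snd_swap] at this ⊢
      rw [this]
      refine tsum_congr fun z => ?_
      exact ((hq.invariant z).mul_right (u z)).tsum_eq
    simp only [mul_sub]
    rw [s2.tsum_sub s1, t1, t2, sub_self]
  -- Clamping to [-n, n] is 1-Lipschitz, so the increments of the clamped functions stay below those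
  -- of f; at each point the clamp is eventually inactive.
  let cl : ℕ → S → ℝ := fun n x => max (-(n : ℝ)) (min (f x) n)
  have hcl1 : ∀ n x, |cl n x| ≤ n := by
    intro n x
    have hn : (0 : ℝ) ≤ n := n.cast_nonneg
    rw [abs_le]
    exact ⟨le_max_left _ _, max_le (by linarith) (min_le_right _ _)⟩
  have hcl2 : ∀ n x z, |cl n z - cl n x| ≤ |f z - f x| := by
    intro n x z
    calc |cl n z - cl n x| ≤ |min (f z) n - min (f x) n| := by
          simpa using abs_max_sub_max_le_max (-(n : ℝ)) (min (f z) n) (-(n : ℝ)) (min (f x) n)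
      _ ≤ |f z - f x| := by simpa using abs_min_sub_min_le_max (f z) (n : ℝ) (f x) n
  have hcl3 : ∀ x, Tendsto (fun n => cl n x) atTop (𝓝 (f x)) := by
    intro x
    refine tendsto_const_nhds.congr' ?_
    obtain ⟨n₀, hn₀⟩ := exists_nat_ge |f x|
    filter_upwards [eventually_ge_atTop n₀] with n hn
    have h : |f x| ≤ n := hn₀.trans (by exact_mod_cast hn)
    rw [abs_le] at h
    simp only [cl]
    rw [min_eq_left h.2, max_eq_right h.1]
  have hle : ∀ (a : S × S) (t : ℝ), |t| ≤ |f a.2 - f a.1| →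
      ‖q a.1 * R a.1 a.2 * t‖ ≤ q a.1 * R a.1 a.2 * M := by
    intro a t ht
    rw [norm_mul, Real.norm_of_nonneg (hqR a.1 a.2)]
    by_cases h0 : R a.1 a.2 = 0
    · simp [h0]
    · exact mul_le_mul_of_nonneg_left (ht.trans (hf _ _ h0)) (hqR _ _)
  have hsum : Summable fun a : S × S => q a.1 * R a.1 a.2 * (f a.2 - f a.1) :=
    Summable.of_norm_bounded (hS.mul_right M) fun a => hle a _ le_rfl
  have hlim := tendsto_tsum_of_dominated_convergence (𝓕 := atTop)
    (f := fun n (a : S × S) => q a.1 * R a.1 a.2 * (cl n a.2 - cl n a.1))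
    (hS.mul_right M)
    (fun a => ((hcl3 a.2).sub (hcl3 a.1)).const_mul (q a.1 * R a.1 a.2))
    (Eventually.of_forall fun n a => hle a _ (hcl2 n _ _))
  have hzero : ∑' a : S × S, q a.1 * R a.1 a.2 * (f a.2 - f a.1) = 0 := by
    refine tendsto_nhds_unique hlim ?_
    simp only [fun n => hbd (cl n) ⟨n, hcl1 n⟩]
    exact tendsto_const_nhds
  have hs := hsum.hasSum
  rw [hzero] at hs
  have := hs.prod_fiberwise fun x => (hsum.prod_factor x).hasSum
  simpa only [mul_assoc, tsum_mul_left] using this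

end Increments

/-! ### Sums over the state space, level by level -/

section Levels

variable {M₀ M₁ : ℕ}

instance Phase.instFintype : ∀ k, Fintype (Phase M₀ M₁ k)
  | 0 => inferInstanceAs (Fintype (Fin M₀))
  | _ + 1 => inferInstanceAs (Fintype (Fin M₁))

/-- The state of level `0` with phase `i`. -/
def ground (i : Fin M₀) : State M₀ M₁ := ⟨0, i⟩

/-- The state of level `m + 1` with phase `i`. -/
def upper (m : ℕ) (i : Fin M₁) : State M₀ M₁ := ⟨m + 1, i⟩

lemma forall_state {Q : State M₀ M₁ → Prop} :
    (∀ x, Q x) ↔ (∀ i, Q (ground i)) ∧ ∀ m i, Q (upper m i) :=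
  ⟨fun h => ⟨fun _ => h _, fun _ _ => h _⟩, fun h x => match x with
    | ⟨0, i⟩ => h.1 i
    | ⟨m + 1, i⟩ => h.2 m i⟩

/-- The sum of a function over the states of a level. -/
def levelSum {α : Type*} [AddCommMonoid α] (F : State M₀ M₁ → α) : ℕ → α
  | 0 => ∑ j : Fin M₀, F (ground j)
  | l + 1 => ∑ j : Fin M₁, F (upper l j)

lemma hasSum_levelSum {α : Type*} [AddCommMonoid α] [TopologicalSpace α] [ContinuousAdd α]
    [RegularSpace α] {F : State M₀ M₁ → α} {a : α} (h : HasSum F a) : HasSum (levelSum F) a := by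
  refine h.sigma fun k => ?_
  cases k with
  | zero => exact hasSum_fintype (fun j : Fin M₀ => F (ground j))
  | succ k => exact hasSum_fintype (fun j : Fin M₁ => F (upper k j))

/-- The restriction of a function on the states to the positive levels, with value `0` at level
index `0`. -/
def res {α : Type*} [Zero α] (v : State M₀ M₁ → α) : ℕ → Fin M₁ → α
  | 0 => 0
  | m + 1 => fun j => v (upper m j)

namespace Blocks

variable (D : Blocks M₀ M₁)

/-- The increment blocks `A(-1), A(0), A(1), …`, enumerated from `0`. -/
def inc : ℕ → Matrix (Fin M₁) (Fin M₁) ℝ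
  | 0 => D.Adown
  | n + 1 => D.A n

lemma transition_zero_succ (l : ℕ) (i : Fin M₀) (j : Fin M₁) :
    D.transition (ground i) (upper l j) = D.B (l + 1) i j := rfl

lemma transition_add_two_zero (k : ℕ) (i : Fin M₁) (j : Fin M₀) :
    D.transition (upper (k + 1) i) (ground j) = 0 := rfl

lemma transition_succ_succ (k l : ℕ) (i j : Fin M₁) :
    D.transition (upper k i) (upper l j) =
      if k ≤ l then D.A (l - k) i j else if k = l + 1 then D.Adown i j else 0 := by
  cases k <;> rfl

lemma transition_inc (m n l : ℕ) (h : m + n = l + 1) (i j : Fin M₁) :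
    D.transition (upper m i) (upper l j) = D.inc n i j := by
  rw [transition_succ_succ]
  cases n with
  | zero => rw [if_neg (by omega), if_pos (by omega)]; rfl
  | succ n => rw [if_pos (by omega), show l - m = n by omega]; rfl

lemma transition_eq_zero (m l : ℕ) (h : l + 1 < m) (i j : Fin M₁) :
    D.transition (upper m i) (upper l j) = 0 := by
  rw [transition_succ_succ, if_neg (by omega), if_neg (by omega)]

/-! ### Rows of the block matrix as series over increments -/

section Rows

variable {α : Type*} [NonUnitalNonAssocSemiring α] [TopologicalSpace α] [ContinuousAdd α]
    [RegularSpace α] {c : ℝ → α} {v : State M₀ M₁ → α} {a : α}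

/-- From level m + 1 the chain reaches only levels m + n with n ≥ 0, through `inc n`; the exception
is m + n = 0, reached through B(-1). The map `c` serves real and extended entries at once. -/
lemma hasSum_row (hc : c 0 = 0) (m : ℕ) (i : Fin M₁)
    (h : HasSum (fun z => c (D.transition (upper m i) z) * v z) a) :
    HasSum (fun n => if m + n = 0 then ∑ j : Fin M₀, c (D.Bdown i j) * v (ground j)
      else ∑ j, c (D.inc n i j) * res v (m + n) j) a := by
  have h1 := hasSum_levelSum h
  rw [← (add_right_injective m).hasSum_iff (f := levelSum _)] at h1
  · convert h1 using 2 with n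
    simp only [Function.comp_apply]
    split_ifs with h0
    · obtain ⟨rfl, rfl⟩ : m = 0 ∧ n = 0 := by omega
      rfl
    · obtain ⟨l, hl⟩ := Nat.exists_eq_succ_of_ne_zero h0
      rw [hl]
      exact Finset.sum_congr rfl fun j _ => by rw [← D.transition_inc m n l hl]; rfl
  · intro l hl
    have hlm : l < m := by
      by_contra hlt
      exact hl ⟨l - m, by simp only; omega⟩
    obtain ⟨k, rfl⟩ : ∃ k, m = k + 1 := ⟨m - 1, by omega⟩
    cases l with
    | zero =>
      exact Finset.sum_eq_zero fun j _ => by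
        simp only [transition_add_two_zero, hc, zero_mul]
    | succ l =>
      exact Finset.sum_eq_zero fun j _ => by
        simp only [D.transition_eq_zero (k + 1) l hlm, hc, zero_mul]

lemma hasSum_row_of_zero (hc : c 0 = 0) (hv : ∀ j : Fin M₀, v (ground j) = 0) (m : ℕ) (i : Fin M₁)
    (h : HasSum (fun z => c (D.transition (upper m i) z) * v z) a) :
    HasSum (fun n => ∑ j, c (D.inc n i j) * res v (m + n) j) a := by
  convert D.hasSum_row hc m i h using 2 with n
  split_ifs with h0
  · rw [h0]; simp [res, hv]
  · rfl

lemma hasSum_row_add_two (hc : c 0 = 0) (m : ℕ) (i : Fin M₁)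
    (h : HasSum (fun z => c (D.transition (upper (m + 1) i) z) * v z) a) :
    HasSum (fun n => ∑ j : Fin M₁, c (D.inc n i j) * v (upper (m + n) j)) a := by
  convert D.hasSum_row hc (m + 1) i h using 2 with n
  rw [if_neg (by omega), Nat.add_right_comm m 1 n]
  rfl

lemma hasSum_row_zero (i : Fin M₀)
    (h : HasSum (fun z => c (D.transition (ground i) z) * v z) a) :
    HasSum (fun n => if n = 0 then ∑ j : Fin M₀, c (D.Bzero i j) * v (ground j)
      else ∑ j, c (D.B n i j) * res v n j) a := by
  convert hasSum_levelSum h using 2 with n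
  cases n with
  | zero => rfl
  | succ n => rfl

end Rows

lemma hasSum_row_real {f : State M₀ M₁ → ℝ} {a : ℝ} (m : ℕ) (i : Fin M₁)
    (h : HasSum (fun z => D.transition (upper m i) z * f z) a) :
    HasSum (fun n => (D.inc n *ᵥ res f (m + n)) i)
      (a - if m = 0 then (D.Bdown *ᵥ fun j => f (ground j)) i else 0) := by
  have h1 := D.hasSum_row (c := id) rfl m i h
  have h2 := hasSum_ite_eq (0 : ℕ) (if m = 0 then (D.Bdown *ᵥ fun j => f (ground j)) i else 0)
  refine hasSum_of_eq (h1.sub h2) (fun n => ?_) rfl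
  by_cases hm : m = 0
  · by_cases hn : n = 0
    · subst hm hn
      simp [res, mulVec, dotProduct]
    · subst hm
      simp [hn, mulVec, dotProduct]
  · simp [hm, mulVec, dotProduct]

lemma act_full_row (v : State M₀ M₁ → ℝ≥0∞) (hv : ∀ j : Fin M₀, v (ground j) = 0) (m : ℕ)
    (i : Fin M₁) :
    act (full D.transition) v (upper m i)
      = ∑' n, ∑ j, ENNReal.ofReal (D.inc n i j) * res v (m + n) j :=
  (D.hasSum_row_of_zero (c := ENNReal.ofReal) ENNReal.ofReal_zero hv m i
    ENNReal.summable.hasSum).tsum_eq.symm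

lemma act_taboo_row (v : State M₀ M₁ → ℝ≥0∞) (m : ℕ) (i : Fin M₁) :
    act (taboo D.transition (levelSet M₀ M₁ 0)) v (upper m i)
      = ∑' n, ∑ j, ENNReal.ofReal (D.inc n i j) * res v (m + n) j := by
  classical
  rw [act_taboo, D.act_full_row _ (fun j => if_pos rfl)]
  refine tsum_congr fun n => Finset.sum_congr rfl fun j _ => ?_
  congr 1
  cases m + n with
  | zero => rfl
  | succ l => exact if_neg (Nat.succ_ne_zero l)

/-- The mean entry time into level `0`. -/
def descent : State M₀ M₁ → ℝ≥0∞ := pot (taboo D.transition (levelSet M₀ M₁ 0)) 1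

/-- The mean entry times into level `0` from the positive levels, as real numbers. -/
def descentReal (m : ℕ) (i : Fin M₁) : ℝ := (res D.descent m i).toReal

/-- A homogeneous solution of the Toeplitz equation which vanishes at `0` and grows at most like
the mean descent times is zero. -/
theorem toeplitz_unique_of_le_descent (hfin : ∀ x, D.descent x ≠ ⊤) (hinc : ∀ n i j, 0 ≤ D.inc n i j)
    {φ : ℕ → Fin M₁ → ℝ} (h0 : φ 0 = 0) {a b : ℝ}
    (hle : ∀ m i, |φ m i| ≤ a + b * D.descentReal m i)
    (hφ : ∀ m i, HasSum (fun n => (D.inc n *ᵥ φ (m + n)) i) (φ (m + 1) i)) (m : ℕ) : φ m = 0 := by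
  let w : State M₀ M₁ → ℝ≥0∞ := fun x => match x with
    | ⟨0, _⟩ => 0
    | ⟨l + 1, j⟩ => ‖φ (l + 1) j‖ₑ
  have hres : ∀ l j, res w l j = ‖φ l j‖ₑ := by
    intro l j
    cases l with
    | zero => simp [res, h0]
    | succ l => rfl
  -- By the triangle inequality |φ| is subharmonic for the kernel killed at level 0.
  have key := eq_zero_of_le_act (K := taboo D.transition (levelSet M₀ M₁ 0)) (w := w) hfin
    (a := ENNReal.ofReal a) (b := ENNReal.ofReal b)
    ENNReal.ofReal_ne_top ENNReal.ofReal_ne_top ?_ ?_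
  · funext i
    cases m with
    | zero => rw [h0]
    | succ m =>
      exact enorm_eq_zero.mp (key (upper m i))
  · refine forall_state.mpr ⟨fun i => zero_le, fun m i => ?_⟩
    · rw [D.act_taboo_row]
      simp only [hres]
      show ‖φ (m + 1) i‖ₑ ≤ _
      rw [← (hφ m i).tsum_eq]
      refine enorm_tsum_le_tsum_enorm.trans (ENNReal.tsum_le_tsum fun n => ?_)
      refine (enorm_sum_le _ _).trans_eq (Finset.sum_congr rfl fun j _ => ?_)
      rw [enorm_mul, Real.enorm_of_nonneg (hinc n i j)]
  · refine forall_state.mpr ⟨fun i => zero_le, fun m i => ?_⟩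
    · have h1 := hle (m + 1) i
      show ‖φ (m + 1) i‖ₑ ≤ _
      rw [← ofReal_norm, Real.norm_eq_abs]
      refine (ENNReal.ofReal_le_ofReal h1).trans (ENNReal.ofReal_add_le.trans ?_)
      gcongr
      rw [descentReal, ENNReal.ofReal_mul' ENNReal.toReal_nonneg]
      gcongr
      exact ENNReal.ofReal_toReal_le

/-! ### Consequences of stochasticity -/

variable {D}

lemma inc_nonneg (hP : IsStochastic D.transition) (n : ℕ) (i j : Fin M₁) : 0 ≤ D.inc n i j := by
  rw [← D.transition_inc 1 n n (add_comm 1 n)]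
  exact hP.1 _ _

lemma hasSum_inc_row (hP : IsStochastic D.transition) (i : Fin M₁) :
    HasSum (fun n => ∑ j, D.inc n i j) 1 := by
  have := D.hasSum_row_add_two (c := id) (v := 1) rfl 0 i (a := 1)
    (by simpa using hP.2 (upper 1 i : State M₀ M₁))
  simpa using this

lemma summable_inc (hP : IsStochastic D.transition) : Summable D.inc := by
  refine Pi.summable.mpr fun i => Pi.summable.mpr fun j => ?_
  refine Summable.of_nonneg_of_le (fun n => inc_nonneg hP n i j) (fun n => ?_)
    (hasSum_inc_row hP i).summable
  exact Finset.single_le_sum (f := fun j => D.inc n i j) (fun j _ => inc_nonneg hP n i j)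
    (Finset.mem_univ j)

/-- The chain descends at most one level per step, so from level m no mass is killed during the
first m - 1 steps. Hence linear growth is controlled by descent times. -/
lemma natCast_le_descent (hP : IsStochastic D.transition) (m : ℕ) (i : Fin M₁) :
    (m : ℝ≥0∞) ≤ res D.descent m i := by
  cases m with
  | zero => simp
  | succ m =>
    have key : ∀ n m (i : Fin M₁), n ≤ m →
        (act (taboo D.transition (levelSet M₀ M₁ 0)))^[n] 1 (upper m i) = 1 := by
      intro n
      induction n with
      | zero => intro m i _; rfl
      | succ n ih =>
        intro m i hm
        rw [Function.iterate_succ_apply', D.act_taboo_row]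
        have h1 : ∀ n' j, res ((act (taboo D.transition (levelSet M₀ M₁ 0)))^[n] 1) (m + n') j
            = 1 := by
          intro n' j
          obtain ⟨l, hl⟩ : ∃ l, m + n' = l + 1 := ⟨m + n' - 1, by omega⟩
          rw [hl]
          exact ih l j (by omega)
        simp only [h1, mul_one]
        have h2 := hasSum_inc_row hP i
        have h3 : ∀ n', ∑ j, ENNReal.ofReal (D.inc n' i j) = ENNReal.ofReal (∑ j, D.inc n' i j) :=
          fun n' => (ENNReal.ofReal_sum_of_nonneg fun j _ => inc_nonneg hP n' i j).symm
        simp only [h3]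
        rw [← ENNReal.ofReal_tsum_of_nonneg
          (fun n' => Finset.sum_nonneg fun j _ => inc_nonneg hP n' i j) h2.summable, h2.tsum_eq,
          ENNReal.ofReal_one]
    have h1 : ∑ n ∈ Finset.range (m + 1),
        (act (taboo D.transition (levelSet M₀ M₁ 0)))^[n] 1 (upper m i)
        ≤ D.descent (upper m i) := ENNReal.sum_le_tsum _
    rw [Finset.sum_congr rfl fun n hn => key n m i (by
      have := Finset.mem_range.mp hn; omega)] at h1
    simpa [res] using h1

lemma natCast_le_descentReal (hP : IsStochastic D.transition) (hfin : ∀ x, D.descent x ≠ ⊤)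
    (m : ℕ) (i : Fin M₁) : (m : ℝ) ≤ D.descentReal m i := by
  have h := natCast_le_descent hP m i
  have h2 : res D.descent m i ≠ ⊤ := by
    cases m with
    | zero => simp [res]
    | succ m => exact hfin _
  simpa [descentReal] using ENNReal.toReal_mono h2 h

/-- A homogeneous solution of the Toeplitz equation which vanishes at `0` and has at most linear
growth is zero. -/
theorem toeplitz_unique (hP : IsStochastic D.transition) (hfin : ∀ x, D.descent x ≠ ⊤)
    {φ : ℕ → Fin M₁ → ℝ} (h0 : φ 0 = 0) {a b : ℝ} (hb : 0 ≤ b)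
    (hle : ∀ m i, |φ m i| ≤ a + b * m)
    (hφ : ∀ m i, HasSum (fun n => (D.inc n *ᵥ φ (m + n)) i) (φ (m + 1) i)) (m : ℕ) : φ m = 0 :=
  D.toeplitz_unique_of_le_descent hfin (inc_nonneg hP) h0 (fun m i => (hle m i).trans
    (add_le_add le_rfl (mul_le_mul_of_nonneg_left (natCast_le_descentReal hP hfin m i) hb)))
    hφ m

/-- The real form of the first-step equation for potentials killed at level `0`. -/
lemma hasSum_inc_pot (hP : IsStochastic D.transition) {r : State M₀ M₁ → ℝ≥0∞}
    (hpot : ∀ x, pot (taboo D.transition (levelSet M₀ M₁ 0)) r x ≠ ⊤) (m : ℕ) (i : Fin M₁) :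
    HasSum (fun n => (D.inc n *ᵥ
        (res fun x => (pot (taboo D.transition (levelSet M₀ M₁ 0)) r x).toReal) (m + n)) i)
      ((pot (taboo D.transition (levelSet M₀ M₁ 0)) r (upper m i)).toReal
        - (r (upper m i)).toReal) := by
  obtain ⟨v, hv⟩ : ∃ v, v = pot (taboo D.transition (levelSet M₀ M₁ 0)) r := ⟨_, rfl⟩
  rw [← hv] at hpot ⊢
  have e : v (upper m i) = r (upper m i) + ∑' n, ∑ j, ENNReal.ofReal (D.inc n i j) * res v (m + n) j := by
    rw [← D.act_taboo_row, hv, ← pot_eq]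
  have hr : r (upper m i) ≠ ⊤ := fun h => hpot (upper m i) (by rw [e, h, top_add])
  have ht : ∑' n, ∑ j, ENNReal.ofReal (D.inc n i j) * res v (m + n) j ≠ ⊤ :=
    fun h => hpot (upper m i) (by rw [e, h, add_top])
  have hres : ∀ l j, res v l j ≠ ⊤ := by
    intro l j
    cases l with
    | zero => simp [res]
    | succ l => exact hpot _
  have hterm : ∀ n j, ENNReal.ofReal (D.inc n i j) * res v (m + n) j ≠ ⊤ := fun n j =>
    ENNReal.mul_ne_top ENNReal.ofReal_ne_top (hres _ _)
  have hs := ENNReal.hasSum_toReal ht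
  refine hasSum_of_eq hs (fun n => ?_) ?_
  · rw [ENNReal.toReal_sum fun j _ => hterm n j]
    refine Finset.sum_congr rfl fun j _ => ?_
    rw [ENNReal.toReal_mul, ENNReal.toReal_ofReal (inc_nonneg hP n i j)]
    congr 1
    cases m + n <;> rfl
  · rw [← ENNReal.tsum_toReal_eq (fun n => ENNReal.sum_ne_top.mpr fun j _ => hterm n j), e,
      ENNReal.toReal_add hr ht]
    ring

end Blocks

end Levels

/-! ### Matrix series with bounded factors -/

section MatrixSums

variable {m n ι : Type*} [Fintype n]

lemma hasSum_mulVec {A : ι → Matrix m n ℝ} {M : Matrix m n ℝ} (h : HasSum A M) (x : n → ℝ) :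
    HasSum (fun t => A t *ᵥ x) (M *ᵥ x) :=
  h.map (mulVec.addMonoidHomLeft x) (continuous_id.matrix_mulVec continuous_const)

lemma abs_mulVec_le {M : Matrix m n ℝ} (h0 : ∀ i j, 0 ≤ M i j) (h1 : ∀ i j, M i j ≤ 1)
    (x : n → ℝ) (i : m) : |(M *ᵥ x) i| ≤ ∑ j, |x j| := by
  refine (Finset.abs_sum_le_sum_abs _ _).trans (Finset.sum_le_sum fun j _ => ?_)
  rw [abs_mul, abs_of_nonneg (h0 i j)]
  exact mul_le_of_le_one_left (abs_nonneg _) (h1 i j)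

lemma summable_mul_mul {p q : Type*} [Fintype q] {C : ι → Matrix m n ℝ} (hC : Summable C)
    {E : ι → Matrix n q ℝ} {c : ℝ} (hE : ∀ t i j, |E t i j| ≤ c) (F : Matrix q p ℝ) :
    Summable fun t => C t * E t * F := by
  refine Pi.summable.mpr fun i => Pi.summable.mpr fun j => ?_
  simp only [Matrix.mul_apply, Finset.sum_mul]
  refine summable_sum fun x _ => summable_sum fun y _ => Summable.mul_right _ ?_
  have h1 := (Pi.summable.mp (Pi.summable.mp hC i) y).abs
  refine Summable.of_norm_bounded (h1.mul_right c) fun t => ?_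
  rw [norm_mul, Real.norm_eq_abs, Real.norm_eq_abs]
  exact mul_le_mul_of_nonneg_left (hE t y x) (abs_nonneg _)

end MatrixSums

namespace Blocks

variable {M₀ M₁ : ℕ} {D : Blocks M₀ M₁}

/-! ### The matrix `G` -/

open Classical in
/-- The probability of entering level `1` at `(1, j)`, extended to level `1` itself by the
indicator of `(1, j)`. -/
def entry (D : Blocks M₀ M₁) (j : Fin M₁) (x : State M₀ M₁) : ℝ≥0∞ :=
  if x ∈ levelSet M₀ M₁ 1 then if x = upper 0 j then 1 else 0
  else pot (taboo D.transition (levelSet M₀ M₁ 1)) (fun z => full D.transition z (upper 0 j)) x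

lemma pot_entry (j : Fin M₁) (x : State M₀ M₁) :
    pot (taboo D.transition (levelSet M₀ M₁ 1)) (fun z => full D.transition z (upper 0 j)) x
      = act (full D.transition) (D.entry j) x := by
  classical
  have h : full D.transition x (upper 0 j)
      = ∑' z, full D.transition x z * if z = upper 0 j then 1 else 0 := by
    rw [tsum_eq_single (upper 0 j) (fun z hz => by simp [hz])]
    simp
  rw [pot_eq, act_taboo, h, act, ← ENNReal.tsum_add]
  refine tsum_congr fun z => ?_
  rw [← mul_add]
  congr 1
  by_cases hz : z ∈ levelSet M₀ M₁ 1
  · simp [entry, hz]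
  · have : z ≠ upper 0 j := fun h => hz (by rw [h]; rfl)
    simp [entry, hz, this]

/-- The constant 1 is excessive: the unit mass of a row covers both the jump to the target and the
jumps avoiding level 1. -/
lemma entry_le_one (hP : IsStochastic D.transition) (j : Fin M₁) (x : State M₀ M₁) :
    D.entry j x ≤ 1 := by
  unfold entry
  split_ifs
  · rfl
  · exact zero_le
  · refine MG1.pot_le (w := 1) (fun x => ?_) x
    have h1 := act_taboo_singleton (P := D.transition) (upper 0 j) x 1
    rw [hP.act_full_one, Pi.one_apply, mul_one, add_comm] at h1
    rw [Pi.one_apply, ← h1]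
    gcongr
    refine ENNReal.tsum_le_tsum fun z => ?_
    gcongr
    refine taboo_anti _ ?_ x z
    rintro _ rfl
    rfl

/-- The matrix of the probabilities of entering level `1` from level `m + 1`. -/
def entryMatrix (D : Blocks M₀ M₁) (m : ℕ) : Matrix (Fin M₁) (Fin M₁) ℝ :=
  fun i j => (D.entry j (upper m i)).toReal

lemma entryMatrix_zero : D.entryMatrix 0 = 1 := by
  ext i j
  have h : (upper 0 i : State M₀ M₁) ∈ levelSet M₀ M₁ 1 := rfl
  have h2 : (upper 0 i : State M₀ M₁) = upper 0 j ↔ i = j := by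
    constructor
    · intro h
      exact eq_of_heq (Sigma.mk.inj h).2
    · rintro rfl; rfl
  simp only [entryMatrix, entry, h, if_true, h2, Matrix.one_apply]
  split_ifs <;> simp

lemma entryMatrix_nonneg (m : ℕ) (i j : Fin M₁) : 0 ≤ D.entryMatrix m i j :=
  ENNReal.toReal_nonneg

lemma entryMatrix_le_one (hP : IsStochastic D.transition) (m : ℕ) (i j : Fin M₁) :
    D.entryMatrix m i j ≤ 1 := by
  simpa [entryMatrix] using ENNReal.toReal_mono ENNReal.one_ne_top (entry_le_one hP j (upper m i))

lemma hasSum_inc_entryMatrix (hP : IsStochastic D.transition) (m : ℕ) :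
    HasSum (fun n => D.inc n * D.entryMatrix (m + n)) (D.entryMatrix (m + 1)) := by
  refine Pi.hasSum.mpr fun i => Pi.hasSum.mpr fun j => ?_
  have hx : (upper (m + 1) i : State M₀ M₁) ∉ levelSet M₀ M₁ 1 := by
    simp [levelSet, upper]
  have hact : D.entry j (upper (m + 1) i) = act (full D.transition) (D.entry j) (upper (m + 1) i) := by
    rw [← pot_entry, entry, if_neg hx]
  have h1 := hasSum_of_act hP.1 (v := D.entry j) (x := upper (m + 1) i)
    (fun z => ne_top_of_le_ne_top ENNReal.one_ne_top (entry_le_one hP j z))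
    (by rw [← hact]; exact ne_top_of_le_ne_top ENNReal.one_ne_top (entry_le_one hP j _))
  have h2 := D.hasSum_row_add_two (c := id) rfl m i h1
  rw [← hact] at h2
  exact h2

/-- With E(m) the entry matrix, E(m+1) and E(m) E(1) are bounded, solve the same Toeplitz equation
and agree at m = 0. Uniqueness replaces the strong Markov property at the successive level entries.
-/
lemma entryMatrix_eq_pow (hP : IsStochastic D.transition) (hfin : ∀ x, D.descent x ≠ ⊤) (m : ℕ) :
    D.entryMatrix m = D.entryMatrix 1 ^ m := by
  have key : ∀ m, D.entryMatrix (m + 1) = D.entryMatrix m * D.entryMatrix 1 := by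
    intro m
    ext i j
    have := toeplitz_unique hP hfin
      (φ := fun m i => D.entryMatrix (m + 1) i j - (D.entryMatrix m * D.entryMatrix 1) i j)
      (by funext i; simp [entryMatrix_zero]) (a := 1 + M₁) (b := 0) le_rfl
      (fun m i => ?_) (fun m i => ?_) m
    · exact sub_eq_zero.mp (congrFun this i)
    · rw [zero_mul, add_zero]
      refine (abs_sub _ _).trans (add_le_add ?_ ?_)
      · rw [abs_of_nonneg (entryMatrix_nonneg _ _ _)]
        exact entryMatrix_le_one hP _ _ _
      · refine (abs_mulVec_le (M := D.entryMatrix m) (entryMatrix_nonneg m)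
          (entryMatrix_le_one hP m) (fun i => D.entryMatrix 1 i j) i).trans ?_
        calc ∑ i, |D.entryMatrix 1 i j| ≤ ∑ _i : Fin M₁, (1 : ℝ) := by
              refine Finset.sum_le_sum fun i _ => ?_
              rw [abs_of_nonneg (entryMatrix_nonneg _ _ _)]
              exact entryMatrix_le_one hP _ _ _
          _ = M₁ := by simp
    · have h1 := hasSum_inc_entryMatrix hP (m + 1)
      have h2 := (hasSum_inc_entryMatrix hP m).mul_right (D.entryMatrix 1)
      have h3 := Pi.hasSum.mp (Pi.hasSum.mp (h1.sub h2) i) j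
      refine hasSum_of_eq h3 (fun n => ?_) rfl
      simp only [Matrix.mul_assoc, Matrix.sub_apply, Matrix.mul_apply, mulVec, dotProduct, mul_sub,
        Finset.sum_sub_distrib, Nat.add_right_comm m 1 n]
  induction m with
  | zero => rw [entryMatrix_zero, pow_zero]
  | succ m ih => rw [key, ih, pow_succ]

/-- The facts on a candidate for the matrix `G` which are used in the sequel. -/
structure IsG (D : Blocks M₀ M₁) (G : Matrix (Fin M₁) (Fin M₁) ℝ) : Prop where
  pow_nonneg : ∀ m i j, 0 ≤ (G ^ m) i j
  pow_le_one : ∀ m i j, (G ^ m) i j ≤ 1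
  hasSum_inc : ∀ m, HasSum (fun n => D.inc n * G ^ (m + n)) (G ^ (m + 1))

lemma isG_entryMatrix (hP : IsStochastic D.transition) (hfin : ∀ x, D.descent x ≠ ⊤) :
    D.IsG (D.entryMatrix 1) where
  pow_nonneg m := by rw [← entryMatrix_eq_pow hP hfin]; exact entryMatrix_nonneg m
  pow_le_one m := by rw [← entryMatrix_eq_pow hP hfin]; exact entryMatrix_le_one hP m
  hasSum_inc m := by
    simpa only [← entryMatrix_eq_pow hP hfin] using hasSum_inc_entryMatrix hP m

lemma _root_.MG1.IsMarkovChain.Gmat_eq {Ω : Type*} [MeasurableSpace Ω]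
    {ℙ : State M₀ M₁ → Measure Ω} {Z : ℕ → Ω → State M₀ M₁}
    (hZ : IsMarkovChain D.transition ℙ Z) : Gmat ℙ Z = D.entryMatrix 1 := by
  ext i j
  have h := hZ.measure_enter (levelSet M₀ M₁ 1) (upper 1 i) (upper 0 j) rfl
  have hx : (upper 1 i : State M₀ M₁) ∉ levelSet M₀ M₁ 1 := by simp [levelSet, upper]
  rw [entryMatrix, entry, if_neg hx, ← h]
  rfl

lemma IsG.abs_pow_mulVec_le {G : Matrix (Fin M₁) (Fin M₁) ℝ} (hG : D.IsG G) (m : ℕ)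
    (x : Fin M₁ → ℝ) (i : Fin M₁) : |(G ^ m *ᵥ x) i| ≤ ∑ j, |x j| :=
  abs_mulVec_le (hG.pow_nonneg m) (hG.pow_le_one m) x i

lemma IsG.hasSum_inc_mulVec {G : Matrix (Fin M₁) (Fin M₁) ℝ} (hG : D.IsG G) (m : ℕ)
    (x : Fin M₁ → ℝ) :
    HasSum (fun n => D.inc n *ᵥ (G ^ (m + n) *ᵥ x)) (G ^ (m + 1) *ᵥ x) := by
  simpa only [mulVec_mulVec] using hasSum_mulVec (hG.hasSum_inc m) x

/-! ### The matrix `Φ(0)` -/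

lemma IsG.abs_pow_sub_le {G : Matrix (Fin M₁) (Fin M₁) ℝ} (hG : D.IsG G) (a b : ℕ)
    (i j : Fin M₁) : |(G ^ a - G ^ b) i j| ≤ 1 := by
  have h1 := hG.pow_nonneg a i j
  have h2 := hG.pow_nonneg b i j
  have h3 := hG.pow_le_one a i j
  have h4 := hG.pow_le_one b i j
  rw [Matrix.sub_apply, abs_le]
  constructor <;> linarith

lemma IsG.summable_A {G : Matrix (Fin M₁) (Fin M₁) ℝ} (hP : IsStochastic D.transition)
    (hG : D.IsG G) : Summable fun m => D.A m * G ^ m := by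
  have h1 : Summable D.A := (summable_nat_add_iff 1).mpr (summable_inc hP)
  have h2 : ∀ m i j, |(G ^ m) i j| ≤ 1 := fun m i j => by
    rw [abs_of_nonneg (hG.pow_nonneg m i j)]
    exact hG.pow_le_one m i j
  have h3 := summable_mul_mul h1 h2 (1 : Matrix (Fin M₁) (Fin M₁) ℝ)
  simpa only [Matrix.mul_one] using h3

/-- The solution of the Toeplitz equation off level `1` which takes the value `x` at level `1`. -/
def extend (G : Matrix (Fin M₁) (Fin M₁) ℝ) (x : Fin M₁ → ℝ) : ℕ → Fin M₁ → ℝ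
  | 0 => 0
  | m + 1 => G ^ m *ᵥ x

/-- At m = 0 the block A(-1) meets the value 0 and the rest sums to Φ(0) x; the defect there is (I -
Φ(0)) x. -/
lemma IsG.hasSum_inc_extend {G : Matrix (Fin M₁) (Fin M₁) ℝ} (hP : IsStochastic D.transition)
    (hG : D.IsG G) (x : Fin M₁ → ℝ) (m : ℕ) :
    HasSum (fun n => D.inc n *ᵥ extend G x (m + n))
      (extend G x (m + 1) - if m = 0 then (1 - ∑' m, D.A m * G ^ m) *ᵥ x else 0) := by
  cases m with
  | zero =>
    have h1 := hasSum_mulVec (hG.summable_A hP).hasSum x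
    rw [← hasSum_nat_add_iff' 1]
    refine hasSum_of_eq h1 (fun n => ?_) ?_
    · rw [← mulVec_mulVec, zero_add]
      rfl
    · simp [extend, sub_mulVec]
  | succ m =>
    rw [if_neg (by omega), sub_zero]
    refine hasSum_of_eq (hG.hasSum_inc_mulVec m x) (fun n => ?_) rfl
    rw [Nat.add_right_comm]
    rfl

lemma IsG.abs_extend_le {G : Matrix (Fin M₁) (Fin M₁) ℝ} (hG : D.IsG G) (x : Fin M₁ → ℝ) (m : ℕ)
    (i : Fin M₁) : |extend G x m i| ≤ ∑ j, |x j| := by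
  cases m with
  | zero => simpa [extend] using Finset.sum_nonneg fun j _ => abs_nonneg (x j)
  | succ m => exact hG.abs_pow_mulVec_le m x i

lemma isUnit_of_forall_mulVec_eq_zero {n : Type*} [Fintype n] [DecidableEq n] {M : Matrix n n ℝ}
    (h : ∀ x, M *ᵥ x = 0 → x = 0) : IsUnit M := by
  rw [← mulVec_injective_iff_isUnit]
  intro x y hxy
  refine sub_eq_zero.mp (h _ ?_)
  rw [mulVec_sub, sub_eq_zero]
  exact hxy

/-- For x in the kernel, `extend G x` has no defect; being bounded it vanishes, and its value at 1
is x. -/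
lemma IsG.isUnit_one_sub {G : Matrix (Fin M₁) (Fin M₁) ℝ} (hP : IsStochastic D.transition)
    (hfin : ∀ x, D.descent x ≠ ⊤) (hG : D.IsG G) : IsUnit (1 - ∑' m, D.A m * G ^ m) := by
  refine isUnit_of_forall_mulVec_eq_zero fun x hx => ?_
  have h := toeplitz_unique hP hfin (φ := extend G x) rfl (a := ∑ j, |x j|) (b := 0) le_rfl
    (fun m i => by simpa using hG.abs_extend_le x m i)
    (fun m i => by
      have := Pi.hasSum.mp (hG.hasSum_inc_extend hP x m) i
      simpa [hx] using this) 1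
  simpa [extend] using h

/-! ### The mean descent times -/

/-- A vector which is harmonic for a finite irreducible stochastic matrix is constant. -/
lemma _root_.MG1.IsStochastic.eq_of_mulVec_eq {n : Type*} [Fintype n] {A : Matrix n n ℝ}
    (hA : IsStochastic A) (hirr : IsIrred A) {x : n → ℝ} (hx : A *ᵥ x = x) (i j : n) :
    x i = x j := by
  have : Nonempty n := ⟨i⟩
  obtain ⟨i₀, hi₀⟩ := Finite.exists_max x
  have key : ∀ j, x j = x i₀ := by
    intro j
    induction hirr i₀ j with
    | refl => rfl
    | @tail b c _ h ih =>
      -- Maximum principle: where x attains its maximum, the nonnegative deficits average to zero,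
      -- so every successor attains it too.
      have hrow : ∑ z, A b z = 1 := (hasSum_fintype _).unique (hA.2 b)
      have h1 : ∑ z, A b z * (x i₀ - x z) = 0 := by
        simp only [mul_sub, Finset.sum_sub_distrib, ← Finset.sum_mul, hrow, one_mul]
        rw [sub_eq_zero, ← ih]
        exact (congrFun hx b).symm
      have h2 := (Finset.sum_eq_zero_iff_of_nonneg fun z _ =>
        mul_nonneg (hA.1 b z) (sub_nonneg.mpr (hi₀ z))).mp h1 c (Finset.mem_univ c)
      rcases mul_eq_zero.mp h2 with h3 | h3
      · exact absurd h3 h.ne'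
      · linarith
  rw [key i, key j]

lemma dotProduct_one_of_stationary {n : Type*} [Fintype n] {A : Matrix n n ℝ} {w : n → ℝ}
    (hw : IsStationary A w) : w ⬝ᵥ 1 = 1 := by
  simpa [dotProduct] using (hasSum_fintype _).unique hw.total

lemma vecMul_of_stationary {n : Type*} [Fintype n] {A : Matrix n n ℝ} {w : n → ℝ}
    (hw : IsStationary A w) : w ᵥ* A = w :=
  funext fun y => (hasSum_fintype _).unique (hw.invariant y)

lemma mulVec_one_of_stochastic {n : Type*} [Fintype n] {A : Matrix n n ℝ}
    (hA : IsStochastic A) : A *ᵥ 1 = 1 :=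
  funext fun x => by simpa [mulVec, dotProduct] using (hasSum_fintype _).unique (hA.2 x)

/-! ### Rank-one correction of I - A by the drift -/

section Drift

variable {n : Type*} [Fintype n] [DecidableEq n] {A : Matrix n n ℝ} {w a g : n → ℝ}

lemma dotProduct_sub_vecMulVec_mulVec (hw : IsStationary A w) (x : n → ℝ) :
    w ⬝ᵥ ((1 - A - vecMulVec a g) *ᵥ x) = -((w ⬝ᵥ a) * (g ⬝ᵥ x)) := by
  rw [sub_mulVec, sub_mulVec, one_mulVec, dotProduct_sub, dotProduct_sub, dotProduct_mulVec w A x,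
    vecMul_of_stationary hw, vecMulVec_mulVec]
  simp [dotProduct_smul, mul_comm]

/-- Pairing a kernel vector x with w annihilates I - A and leaves g x = 0, as w a ≠ 0. Then A x = x,
so x is constant, and g x = 0 with g e = 1 makes it zero. -/
lemma isUnit_one_sub_sub_vecMulVec (hA : IsStochastic A) (hirr : IsIrred A)
    (hw : IsStationary A w) (ha : w ⬝ᵥ a < 0) (hg : g ⬝ᵥ 1 = 1) :
    IsUnit (1 - A - vecMulVec a g) := by
  refine isUnit_of_forall_mulVec_eq_zero fun x hx => ?_
  have h1 := dotProduct_sub_vecMulVec_mulVec (a := a) (g := g) hw x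
  rw [hx, dotProduct_zero, zero_eq_neg, mul_eq_zero] at h1
  have h2 : g ⬝ᵥ x = 0 := h1.resolve_left ha.ne
  rw [sub_mulVec, sub_mulVec, one_mulVec, vecMulVec_mulVec, h2] at hx
  have h3 : A *ᵥ x = x := by simpa [sub_eq_zero, eq_comm] using hx
  funext i
  have h4 : x = x i • (1 : n → ℝ) := funext fun j => by
    simpa using hA.eq_of_mulVec_eq hirr h3 j i
  rw [h4, dotProduct_smul, hg] at h2
  simpa using h2

/-- The vector `(I - A - a g)⁻¹ e`. -/
lemma sub_mulVec_inv_one (hA : IsStochastic A) (hirr : IsIrred A)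
    (hw : IsStationary A w) (ha : w ⬝ᵥ a < 0) (hg : g ⬝ᵥ 1 = 1) :
    A *ᵥ ((1 - A - vecMulVec a g)⁻¹ *ᵥ 1)
      = (1 - A - vecMulVec a g)⁻¹ *ᵥ 1 - 1 + (1 / (w ⬝ᵥ a)) • a := by
  set x := (1 - A - vecMulVec a g)⁻¹ *ᵥ (1 : n → ℝ) with hx
  have hu := isUnit_one_sub_sub_vecMulVec hA hirr hw ha hg
  have h1 : (1 - A - vecMulVec a g) *ᵥ x = 1 := by
    rw [hx, mulVec_mulVec, mul_nonsing_inv _ ((isUnit_iff_isUnit_det _).mp hu), one_mulVec]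
  have h2 := dotProduct_sub_vecMulVec_mulVec (a := a) (g := g) hw x
  rw [h1, dotProduct_one_of_stationary hw] at h2
  -- Obtained by pairing (I - A - a g) x = e with w.
  have h3 : g ⬝ᵥ x = -(1 / (w ⬝ᵥ a)) := by
    field_simp [ha.ne]
    linarith
  rw [sub_mulVec, sub_mulVec, one_mulVec, vecMulVec_mulVec, h3] at h1
  rw [← h1]
  ext i
  simp
  ring

end Drift

variable {w g : Fin M₁ → ℝ}

lemma hasSum_inc_Asum (hP : IsStochastic D.transition) : HasSum D.inc D.Asum := by
  have h1 : Summable D.A := (summable_nat_add_iff 1).mpr (summable_inc hP)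
  rw [← hasSum_nat_add_iff' 1]
  refine hasSum_of_eq h1.hasSum (fun n => rfl) ?_
  simp [Asum, inc]

lemma hasSum_inc_mA (hA : Summable fun k : ℕ => (k : ℝ) • (D.A k *ᵥ (1 : Fin M₁ → ℝ))) :
    HasSum (fun n : ℕ => ((n : ℝ) - 1) • (D.inc n *ᵥ (1 : Fin M₁ → ℝ))) D.mA := by
  rw [← hasSum_nat_add_iff' 1]
  refine hasSum_of_eq hA.hasSum (fun n => ?_) ?_
  · simp [inc]
  · simp [mA, inc]

/-- The vector `(I - A - m_A g)⁻¹ e`. -/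
def kappa (D : Blocks M₀ M₁) (g : Fin M₁ → ℝ) : Fin M₁ → ℝ :=
  (1 - D.Asum - vecMulVec D.mA g)⁻¹ *ᵥ 1

/-- The explicit form of the mean descent times. -/
def descentFormula (D : Blocks M₀ M₁) (G : Matrix (Fin M₁) (Fin M₁) ℝ) (w g : Fin M₁ → ℝ) (m : ℕ) :
    Fin M₁ → ℝ :=
  D.kappa g - G ^ m *ᵥ D.kappa g + ((m : ℝ) / -(w ⬝ᵥ D.mA)) • 1

/-- The term m_A/σ in A κ cancels against the drift of the linear part m/(-σ) e, leaving the source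
-e. -/
lemma hasSum_inc_descentFormula {G : Matrix (Fin M₁) (Fin M₁) ℝ} (hD : D.Standing w)
    (hG : D.IsG G) (hg : g ⬝ᵥ 1 = 1) (m : ℕ) :
    HasSum (fun n => D.inc n *ᵥ D.descentFormula G w g (m + n))
      (D.descentFormula G w g (m + 1) - 1) := by
  have hinc := hasSum_inc_Asum hD.stochastic
  have h1 := hasSum_mulVec hinc (D.kappa g)
  have h2 := hG.hasSum_inc_mulVec m (D.kappa g)
  have h3 := (hasSum_mulVec hinc 1).const_smul ((m : ℝ) + 1)
  have h4 := ((h3.add (hasSum_inc_mA hD.A_moment)).const_smul (1 / -(w ⬝ᵥ D.mA)))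
  refine hasSum_of_eq ((h1.sub h2).add h4) (fun n => ?_) ?_
  · rw [descentFormula, mulVec_add, mulVec_sub, mulVec_smul]
    congr 1
    ext i
    simp only [Pi.smul_apply, Pi.add_apply, smul_eq_mul]
    push_cast
    ring
  · rw [mulVec_one_of_stochastic hD.A_stochastic, kappa,
      sub_mulVec_inv_one hD.A_stochastic hD.A_irreducible hD.w_stationary hD.drift_neg hg,
      descentFormula, ← kappa]
    have := hD.drift_neg.ne
    ext i
    simp only [Pi.smul_apply, Pi.add_apply, Pi.sub_apply, Pi.one_apply, smul_eq_mul]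
    push_cast
    field_simp
    ring

lemma abs_descentFormula_le {G : Matrix (Fin M₁) (Fin M₁) ℝ} (hD : D.Standing w)
    (hG : D.IsG G) (m : ℕ) (i : Fin M₁) :
    |D.descentFormula G w g m i| ≤ 2 * ∑ j, |D.kappa g j| + 1 / -(w ⬝ᵥ D.mA) * m := by
  have hσ : 0 < -(w ⬝ᵥ D.mA) := neg_pos.mpr hD.drift_neg
  have h1 := hG.abs_pow_mulVec_le m (D.kappa g) i
  have h2 : |D.kappa g i| ≤ ∑ j, |D.kappa g j| :=
    Finset.single_le_sum (f := fun j => |D.kappa g j|) (fun j _ => abs_nonneg _) (Finset.mem_univ i)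
  have h3 : (0 : ℝ) ≤ (m : ℝ) / -(w ⬝ᵥ D.mA) := by positivity
  rw [descentFormula]
  simp only [Pi.smul_apply, Pi.add_apply, Pi.sub_apply, Pi.one_apply, smul_eq_mul, mul_one]
  refine (abs_add_le _ _).trans ?_
  rw [abs_of_nonneg h3, one_div_mul_eq_div]
  have := abs_sub (D.kappa g i) ((G ^ m *ᵥ D.kappa g) i)
  linarith

/-- The difference is dominated by the descent times themselves, so no growth bound is needed
beforehand; linear growth is a consequence. -/
theorem descentReal_eq {G : Matrix (Fin M₁) (Fin M₁) ℝ} (hD : D.Standing w)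
    (hfin : ∀ x, D.descent x ≠ ⊤) (hG : D.IsG G) (hg : g ⬝ᵥ 1 = 1) (m : ℕ) :
    D.descentReal m = D.descentFormula G w g m := by
  have hP := hD.stochastic
  have hσ : 0 < -(w ⬝ᵥ D.mA) := neg_pos.mpr hD.drift_neg
  have hU : ∀ m, D.descentReal m = res (fun x => (D.descent x).toReal) m := by
    intro m
    cases m <;> rfl
  refine sub_eq_zero.mp (D.toeplitz_unique_of_le_descent hfin (inc_nonneg hP)
    (φ := fun m => D.descentReal m - D.descentFormula G w g m) ?_
    (a := 2 * ∑ j, |D.kappa g j|) (b := 1 + 1 / -(w ⬝ᵥ D.mA)) (fun m i => ?_) (fun m i => ?_) m)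
  · simp [hU, res, descentFormula]
  · have h1 := abs_descentFormula_le (g := g) hD hG m i
    have h2 : 1 / -(w ⬝ᵥ D.mA) * m ≤ 1 / -(w ⬝ᵥ D.mA) * D.descentReal m i :=
      mul_le_mul_of_nonneg_left (natCast_le_descentReal hP hfin m i) (by positivity)
    have h3 : |D.descentReal m i| = D.descentReal m i := abs_of_nonneg ENNReal.toReal_nonneg
    have h4 := abs_sub (D.descentReal m i) (D.descentFormula G w g m i)
    simp only [Pi.sub_apply]
    linarith
  · have h1 := hasSum_inc_pot hP (r := 1) hfin m i
    have h2 := Pi.hasSum.mp (hasSum_inc_descentFormula hD hG hg m) i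
    refine hasSum_of_eq (h1.sub h2) (fun n => ?_) ?_
    · simp only [hU, mulVec_sub, Pi.sub_apply]
      rfl
    · simp only [hU, res, Pi.sub_apply, Pi.one_apply, ENNReal.toReal_one, descent]
      ring

lemma descentReal_le {G : Matrix (Fin M₁) (Fin M₁) ℝ} (hD : D.Standing w)
    (hfin : ∀ x, D.descent x ≠ ⊤) (hG : D.IsG G) (hg : g ⬝ᵥ 1 = 1) (m : ℕ) (i : Fin M₁) :
    D.descentReal m i ≤ 2 * ∑ j, |D.kappa g j| + 1 / -(w ⬝ᵥ D.mA) * m := by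
  rw [descentReal_eq hD hfin hG hg]
  exact (le_abs_self _).trans (abs_descentFormula_le hD hG m i)

end Blocks

/-! ### Tail sums -/

section Tails

/-- The value c t is counted once for each of the t + 1 pairs (l, l') with sum t. -/
lemma hasSum_tail {c : ℕ → ℝ} (h0 : ∀ t, 0 ≤ c t) (hc : Summable fun t : ℕ => ((t : ℝ) + 1) * c t) :
    HasSum (fun l => ∑' l', c (l + l')) (∑' t : ℕ, ((t : ℝ) + 1) * c t) := by
  let e := Finset.HasAntidiagonal.sigmaAntidiagonalEquivProd (A := ℕ)
  have hfib : ∀ t : ℕ, ∑ a : Finset.HasAntidiagonal.antidiagonal t, c (a.1.1 + a.1.2) = ((t : ℝ) + 1) * c t := by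
    intro t
    rw [Finset.sum_congr rfl fun a _ => by rw [Finset.HasAntidiagonal.mem_antidiagonal.mp a.2]]
    simp
  have hs : Summable fun a : (Σ t : ℕ, Finset.HasAntidiagonal.antidiagonal t) => c (a.2.1.1 + a.2.1.2) := by
    rw [summable_sigma_of_nonneg fun a => h0 _]
    refine ⟨fun t => Summable.of_finite, ?_⟩
    simpa only [tsum_fintype, hfib] using hc
  have hs' : HasSum (fun a : (Σ t : ℕ, Finset.HasAntidiagonal.antidiagonal t) => c (a.2.1.1 + a.2.1.2))
      (∑' t : ℕ, ((t : ℝ) + 1) * c t) := by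
    have h1 := hs.hasSum.sigma fun t => hasSum_fintype _
    simp only [hfib] at h1
    rw [h1.tsum_eq]
    exact hs.hasSum
  have hp : HasSum (fun a : ℕ × ℕ => c (a.1 + a.2)) (∑' t : ℕ, ((t : ℝ) + 1) * c t) :=
    e.hasSum_iff.mp hs'
  exact hp.prod_fiberwise fun l => (hp.summable.prod_factor l).hasSum

/-- T is the doubly integrated tail at N - 1, and T e = ∑_{n>N} (n - N) C(n) e. Nonnegativity is
asked only from index 1 on, since the entry `B 0` is arbitrary. -/
lemma exists_hasSum_tail {m n : Type*} [Fintype n] {C : ℕ → Matrix m n ℝ}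
    (h0 : ∀ k i j, 0 ≤ C (k + 1) i j)
    (hC : Summable fun k : ℕ => (k : ℝ) • (C k *ᵥ (1 : n → ℝ))) (N : ℕ) :
    ∃ T : Matrix m n ℝ, HasSum (fun l => ∑' l', C (N + l + 1 + l')) T ∧
      HasSum (fun t : ℕ => ((t : ℝ) + 1) • (C (N + 1 + t) *ᵥ (1 : n → ℝ))) (T *ᵥ 1) := by
  have hnn : ∀ t i j, 0 ≤ C (N + 1 + t) i j := fun t i j => by
    rw [Nat.add_right_comm]; exact h0 _ i j
  have hle : ∀ t i j, C (N + 1 + t) i j ≤ (C (N + 1 + t) *ᵥ (1 : n → ℝ)) i := fun t i j => by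
    simpa [mulVec, dotProduct] using
      Finset.single_le_sum (f := fun j => C (N + 1 + t) i j) (fun j _ => hnn t i j)
        (Finset.mem_univ j)
  have hs : ∀ i j, Summable fun t : ℕ => ((t : ℝ) + 1) * C (N + 1 + t) i j := by
    intro i j
    have h1 := (summable_nat_add_iff (N + 1)).mpr (Pi.summable.mp hC i)
    refine Summable.of_nonneg_of_le (fun t => mul_nonneg (by positivity) (hnn t i j))
      (fun t => ?_) h1
    rw [Pi.smul_apply, smul_eq_mul, add_comm t (N + 1)]
    refine mul_le_mul ?_ (hle t i j) (hnn t i j) (by positivity)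
    push_cast
    have : (0 : ℝ) ≤ N := N.cast_nonneg
    linarith
  have hs1 : Summable fun t => C (N + 1 + t) := by
    refine Pi.summable.mpr fun i => Pi.summable.mpr fun j => ?_
    refine Summable.of_nonneg_of_le (fun t => hnn t i j) (fun t => ?_) (hs i j)
    have : (0 : ℝ) ≤ t := t.cast_nonneg
    have := mul_nonneg this (hnn t i j)
    linarith
  refine ⟨fun i j => ∑' t : ℕ, ((t : ℝ) + 1) * C (N + 1 + t) i j, ?_, ?_⟩
  · refine Pi.hasSum.mpr fun i => Pi.hasSum.mpr fun j => ?_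
    refine hasSum_of_eq (hasSum_tail (fun t => hnn t i j) (hs i j)) (fun l => ?_) rfl
    have hs2 : Summable fun l' => C (N + l + 1 + l') := by
      have := (summable_nat_add_iff l).mpr hs1
      refine this.congr fun l' => ?_
      congr 1
      omega
    rw [((Pi.hasSum.mp (Pi.hasSum.mp hs2.hasSum i) j)).tsum_eq.symm]
    refine tsum_congr fun l' => ?_
    rw [show N + 1 + (l + l') = N + l + 1 + l' by omega]
  · refine Pi.hasSum.mpr fun i => ?_
    have := hasSum_sum (s := Finset.univ) fun j (_ : j ∈ Finset.univ) => (hs i j).hasSum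
    refine hasSum_of_eq this (fun t => ?_) ?_
    · simp [mulVec, dotProduct, Finset.mul_sum]
    · simp [mulVec, dotProduct]

/-- The input is the difference of a lumped and an original row: lumping adds the blocks C(t), t ≥
1, at position 0 and deletes them at position t. Regrouping by blocks gives the differences of x. -/
lemma hasSum_lump {m n : Type*} [Fintype n] {C : ℕ → Matrix m n ℝ} (hC : Summable C)
    (x : ℕ → n → ℝ) {δ : ℝ} (i : m)
    (h : HasSum (fun t => if t = 0 then ((∑' t, C t - C 0) *ᵥ x 0) i else -(C t *ᵥ x t) i) δ) :
    HasSum (fun t => (C (t + 1) *ᵥ (x 0 - x (t + 1))) i) δ := by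
  have h1 := (hasSum_nat_add_iff' 1).mpr h
  have h2 := Pi.hasSum.mp (hasSum_mulVec ((hasSum_nat_add_iff' 1).mpr hC.hasSum) (x 0)) i
  refine hasSum_of_eq (h2.add h1) (fun t => ?_) ?_
  · rw [if_neg (Nat.succ_ne_zero t), mulVec_sub, Pi.sub_apply, sub_eq_add_neg]
  · simp

/-- Splitting a series of matrices applied to differences of vectors into three parts. -/
lemma tsum_split {m n q : Type*} [Fintype n] {C : ℕ → Matrix m n ℝ}
    {U U' : ℕ → Matrix n n ℝ} {F S : Matrix n q ℝ} {y : n → ℝ} {z : ℕ → n → ℝ}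
    {τ : m → ℝ} {c : ℝ} (j : q)
    (h1 : Summable fun t => C t * U t * F) (h2 : Summable fun t => C t * U' t * S)
    (hτ : HasSum (fun t : ℕ => ((t : ℝ) + 1) • (C t *ᵥ (1 : n → ℝ))) τ)
    (hz : ∀ t : ℕ, y - z t = U t *ᵥ (fun i => F i j) + U' t *ᵥ (fun i => S i j)
      + (c * ((t : ℝ) + 1)) • 1) (i : m) :
    ∑' t, (C t *ᵥ (y - z t)) i
      = c * τ i + (∑' t, C t * U t * F) i j + (∑' t, C t * U' t * S) i j := by
  have e1 := Pi.hasSum.mp (Pi.hasSum.mp h1.hasSum i) j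
  have e2 := Pi.hasSum.mp (Pi.hasSum.mp h2.hasSum i) j
  have e3 := (Pi.hasSum.mp hτ i).mul_left c
  refine (hasSum_of_eq ((e3.add e1).add e2) (fun t => ?_) rfl).tsum_eq
  rw [hz, mulVec_add, mulVec_add, mulVec_smul, mulVec_mulVec, mulVec_mulVec]
  simp only [Pi.add_apply, Pi.smul_apply, smul_eq_mul, Matrix.mul_apply_eq_vecMul]
  have : ∀ (M : Matrix m n ℝ) (K : Matrix n q ℝ), (M * K) i j = (M *ᵥ fun i => K i j) i :=
    fun M K => rfl
  simp only [← Matrix.mul_apply_eq_vecMul, this]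
  ring

end Tails

namespace Blocks

variable {M₀ M₁ : ℕ} {D : Blocks M₀ M₁}

/-! ### The truncated chain -/

lemma A_nonneg (hP : IsStochastic D.transition) (k : ℕ) (i j : Fin M₁) : 0 ≤ D.A k i j :=
  inc_nonneg hP (k + 1) i j

lemma B_nonneg (hP : IsStochastic D.transition) (k : ℕ) (i : Fin M₀) (j : Fin M₁) :
    0 ≤ D.B (k + 1) i j :=
  hP.1 (ground i) (upper k j)

lemma summable_A (hP : IsStochastic D.transition) (N : ℕ) : Summable fun t => D.A (N + t) := by
  have h : Summable D.A := (summable_nat_add_iff 1).mpr (summable_inc hP)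
  simpa only [add_comm] using (summable_nat_add_iff N).mpr h

lemma summable_B (hP : IsStochastic D.transition) {N : ℕ} (hN : 1 ≤ N) :
    Summable fun t => D.B (N + t) := by
  have h : Summable fun t => D.B (t + 1) := by
    refine Pi.summable.mpr fun i => Pi.summable.mpr fun j => ?_
    have hinj : Function.Injective fun t : ℕ => (upper t j : State M₀ M₁) := fun a b hab => by
      simpa [upper] using congrArg Sigma.fst hab
    exact (hP.2 (ground i)).summable.comp_injective hinj
  have h' := (summable_nat_add_iff (f := fun t => D.B (t + 1)) (N - 1)).mpr h
  refine h'.congr fun t => ?_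
  congr 1
  omega

lemma Abar_eq {N : ℕ} (hN : 1 ≤ N) : D.Abar (N - 1) = ∑' t, D.A (N + t) := by
  rw [Abar, Nat.sub_add_cancel hN]

lemma Bbar_eq {N : ℕ} (hN : 1 ≤ N) : D.Bbar (N - 1) = ∑' t, D.B (N + t) := by
  rw [Bbar, Nat.sub_add_cancel hN]

lemma trunc_jump {N : ℕ} (x z : State M₀ M₁) (h : (D.trunc N).transition x z ≠ 0) :
    z.1 ≤ x.1 + N ∧ x.1 ≤ z.1 + 1 := by
  revert x z
  refine forall_state.mpr ⟨fun i => forall_state.mpr ⟨fun j _ => ?_, fun l j h => ?_⟩,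
    fun m i => forall_state.mpr ⟨fun j h => ?_, fun l j h => ?_⟩⟩
  · simp [ground]
  · simp only [ground, upper]
    refine ⟨?_, by omega⟩
    by_contra hc
    apply h
    rw [transition_zero_succ]
    simp only [trunc]
    rw [if_neg (by omega), if_neg (by omega)]
    rfl
  · cases m with
    | zero => simp [upper, ground]
    | succ m => exact absurd ((D.trunc N).transition_add_two_zero m i j) h
  · simp only [upper]
    rw [transition_succ_succ] at h
    split_ifs at h with h1 h2
    · refine ⟨?_, by omega⟩
      by_contra hc
      apply h
      simp only [trunc]
      rw [if_neg (by omega), if_neg (by omega)]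
      rfl
    · omega
    · exact absurd rfl h

lemma finite_level_le (K : ℕ) : {x : State M₀ M₁ | x.1 ≤ K}.Finite := by
  have : {x : State M₀ M₁ | x.1 ≤ K} ⊆ ↑((Finset.range (K + 1)).sigma
      fun k => (Finset.univ : Finset (Phase M₀ M₁ k))) := by
    intro x hx
    simp only [Finset.coe_sigma, Set.mem_sigma_iff, Finset.coe_range, Set.mem_Iio,
      Finset.mem_coe, Finset.mem_univ, and_true]
    exact Nat.lt_succ_of_le hx
  exact (Finset.finite_toSet _).subset this

lemma trunc_nonneg (hP : IsStochastic D.transition) {N : ℕ} (hN : 1 ≤ N) (x z : State M₀ M₁) :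
    0 ≤ (D.trunc N).transition x z := by
  have hA : ∀ k i j, 0 ≤ (D.trunc N).A k i j := by
    intro k i j
    simp only [trunc]
    split_ifs
    · exact A_nonneg hP k i j
    · rw [Abar_eq hN, ← (Pi.hasSum.mp (Pi.hasSum.mp (summable_A hP N).hasSum i) j).tsum_eq]
      exact tsum_nonneg fun t => A_nonneg hP _ i j
    · exact le_rfl
  revert x z
  refine forall_state.mpr ⟨fun i => forall_state.mpr ⟨fun j => ?_, fun l j => ?_⟩,
    fun m i => forall_state.mpr ⟨fun j => ?_, fun l j => ?_⟩⟩
  · exact hP.1 (ground i) (ground j)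
  · rw [transition_zero_succ]
    simp only [trunc]
    split_ifs
    · exact B_nonneg hP l i j
    · rw [Bbar_eq hN, ← (Pi.hasSum.mp (Pi.hasSum.mp (summable_B hP hN).hasSum i) j).tsum_eq]
      refine tsum_nonneg fun t => ?_
      obtain ⟨k, hk⟩ : ∃ k, N + t = k + 1 := ⟨N + t - 1, by omega⟩
      rw [hk]
      exact B_nonneg hP k i j
    · exact le_rfl
  · cases m with
    | zero => exact hP.1 (upper 0 i) (ground j)
    | succ m => rw [transition_add_two_zero]
  · rw [transition_succ_succ]
    split_ifs
    · exact hA _ i j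
    · exact inc_nonneg hP 0 i j
    · exact le_rfl

/-- The effect of the difference of the truncated and the original transition matrix on `f`. -/
def gap (D : Blocks M₀ M₁) (N : ℕ) (f : State M₀ M₁ → ℝ) : State M₀ M₁ → ℝ
  | ⟨0, i⟩ => ∑' t, (D.B (N + 1 + t) *ᵥ (res f N - res f (N + 1 + t))) i
  | ⟨m + 1, i⟩ =>
      ∑' t, (D.A (N + 1 + t) *ᵥ (res f (N + (m + 1)) - res f (N + 1 + t + (m + 1)))) i

/-- The truncated row has finite support, hence converges, and differs from the original one only in
increments at least N. -/
lemma hasSum_trunc (hP : IsStochastic D.transition) {N : ℕ} (hN : 1 ≤ N) {f : State M₀ M₁ → ℝ}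
    {a : ℝ} (x : State M₀ M₁) (h : HasSum (fun z => D.transition x z * f z) a) :
    HasSum (fun z => (D.trunc N).transition x z * f z) (a + D.gap N f x) := by
  have hs : Summable fun z => (D.trunc N).transition x z * f z := by
    refine summable_of_hasFiniteSupport ((finite_level_le (x.1 + N)).subset fun z hz => ?_)
    exact (trunc_jump x z (left_ne_zero_of_mul hz)).1
  obtain ⟨b, hb⟩ := hs
  suffices hba : D.gap N f x = b - a by rwa [hba, add_sub_cancel]
  revert x
  refine forall_state.mpr ⟨fun i h hb => ?_, fun m i h hb => ?_⟩
  · have h1 := ((D.trunc N).hasSum_row_zero (c := id) i hb).sub (D.hasSum_row_zero (c := id) i h)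
    have h2 := (hasSum_nat_add_iff' N).mpr h1
    rw [Finset.sum_eq_zero (s := Finset.range _), sub_zero] at h2
    · refine (hasSum_of_eq (hasSum_lump (summable_B hP hN) (fun t => res f (N + t)) i
        (hasSum_of_eq h2 (fun t => ?_) rfl)) (fun t => ?_) rfl).tsum_eq
      · rw [if_neg (by omega), if_neg (by omega), ← Bbar_eq hN, add_comm t N]
        simp only [trunc, id]
        rw [if_neg (by omega)]
        by_cases ht : t = 0
        · subst ht
          simp [mulVec, dotProduct, sub_mul]
        · rw [if_neg (by omega), if_neg ht]
          simp [mulVec, dotProduct]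
      · simp only [add_zero, add_assoc, add_comm 1 t]
    · intro n hn
      have := Finset.mem_range.mp hn
      by_cases h0 : n = 0
      · simp [h0, trunc]
      · simp [h0, trunc, this]
  · have h1 := ((D.trunc N).hasSum_row_real m i hb).sub (D.hasSum_row_real m i h)
    -- N + 1 terms agree here, against N at level 0, because `inc` starts with A(-1).
    have h2 := (hasSum_nat_add_iff' (N + 1)).mpr h1
    rw [Finset.sum_eq_zero (s := Finset.range _), sub_zero] at h2
    · refine (hasSum_of_eq (hasSum_lump (summable_A hP N) (fun t => res f (N + t + (m + 1))) i
        (hasSum_of_eq h2 (fun t => ?_) rfl)) (fun t => ?_) ?_).tsum_eq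
      · rw [← Abar_eq hN, ← add_assoc t N 1]
        simp only [inc, trunc]
        rw [if_neg (by omega), show m + (t + N + 1) = N + t + (m + 1) by omega, add_comm t N]
        by_cases ht : t = 0
        · subst ht
          simp [sub_mulVec]
        · rw [if_neg (by omega), if_neg ht]
          simp
      · simp only [add_zero, add_assoc, add_comm 1 t]
      · simp [trunc]
    · intro n hn
      have := Finset.mem_range.mp hn
      cases n with
      | zero => simp [inc, trunc]
      | succ n => simp [inc, trunc, show n < N by omega]

lemma trunc_stochastic (hP : IsStochastic D.transition) {N : ℕ} (hN : 1 ≤ N) :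
    IsStochastic (D.trunc N).transition := by
  refine ⟨trunc_nonneg hP hN, fun x => ?_⟩
  have h := hasSum_trunc hP hN (f := fun _ => 1) (a := 1) x (by simpa using hP.2 x)
  have hr : ∀ l, res (fun _ : State M₀ M₁ => (1 : ℝ)) (l + 1) = 1 := fun l => rfl
  have hg : D.gap N (fun _ => 1) x = 0 := by
    revert x
    refine forall_state.mpr ⟨fun i _ => ?_, fun m i _ => ?_⟩
    -- `res` is 0 at index 0, so only for N ≥ 1 does it return the constant 1 at N.
    · obtain ⟨n, rfl⟩ : ∃ n, N = n + 1 := ⟨N - 1, by omega⟩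
      have : ∀ t, n + 1 + 1 + t = (n + 1 + t) + 1 := fun t => by omega
      simp [gap, ground, hr, this]
    · simp only [gap, upper, ← add_assoc, hr, sub_self, mulVec_zero, Pi.zero_apply, tsum_zero]
  rw [hg] at h
  simpa using h

/-! ### The decomposition of `H` -/

open Classical in
/-- The column `y` of the matrix `H` with reference state `s`. -/
def deviation (D : Blocks M₀ M₁) (p : State M₀ M₁ → ℝ) (s y x : State M₀ M₁) : ℝ :=
  (pot (taboo D.transition {s}) (Pi.single y 1) x).toReal
    - p y * (pot (taboo D.transition {s}) 1 x).toReal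

open Classical in
/-- The column `y` of the matrix `F₊`. -/
def visits (D : Blocks M₀ M₁) (y x : State M₀ M₁) : ℝ :=
  (pot (taboo D.transition (levelSet M₀ M₁ 0)) (Pi.single y 1) x).toReal

lemma visits_le_descent (hfin : ∀ x, D.descent x ≠ ⊤) (y : State M₀ M₁) (m : ℕ) (i : Fin M₁) :
    |res (D.visits y) m i| ≤ D.descentReal m i := by
  classical
  cases m with
  | zero => simp [res, descentReal]
  | succ m =>
    simp only [res, visits, descentReal]
    rw [abs_of_nonneg ENNReal.toReal_nonneg]
    refine ENNReal.toReal_mono (hfin _) ?_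
    exact pot_single_le (P := D.transition) (levelSet M₀ M₁ 0) (upper m i) y

open Classical in
lemma hasSum_inc_visits (hP : IsStochastic D.transition) (hfin : ∀ x, D.descent x ≠ ⊤)
    (y : State M₀ M₁) (m : ℕ) (i : Fin M₁) :
    HasSum (fun n => (D.inc n *ᵥ res (D.visits y) (m + n)) i)
      (res (D.visits y) (m + 1) i - (Pi.single y 1 : State M₀ M₁ → ℝ) (upper m i)) := by
  refine hasSum_of_eq (hasSum_inc_pot hP (r := Pi.single y 1)
    (fun x => ne_top_of_le_ne_top (hfin x) (pot_single_le _ x y)) m i) (fun n => rfl) ?_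
  congr 1
  simp only [Pi.single_apply]
  split_ifs <;> simp

/-- Level 0 is hit no later than any given one of its states. -/
lemma descent_finite (hM₀ : 1 ≤ M₀) (hP : IsStochastic D.transition)
    (hirr : IsIrred D.transition) {p : State M₀ M₁ → ℝ} (hp : IsStationary D.transition p)
    (x : State M₀ M₁) : D.descent x ≠ ⊤ := by
  refine ne_top_of_le_ne_top (hp.meanHit_finite hP hirr (ground ⟨0, hM₀⟩) x)
    (pot_mono_kernel (taboo_anti _ ?_) x)
  rintro _ rfl
  rfl

variable {w g : Fin M₁ → ℝ} {G : Matrix (Fin M₁) (Fin M₁) ℝ} {p : State M₀ M₁ → ℝ}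

/-- `F₊(m; k) = G^(m - k) F₊(k; k)`. -/
lemma visits_upper (hD : D.Standing w) (hfin : ∀ x, D.descent x ≠ ⊤) (hG : D.IsG G)
    (hg : g ⬝ᵥ 1 = 1) (k : ℕ) (j : Fin M₁) (m : ℕ) :
    res (D.visits (upper k j)) (k + 1 + m) = G ^ m *ᵥ res (D.visits (upper k j)) (k + 1) := by
  classical
  have hP := hD.stochastic
  have hσ : 0 < -(w ⬝ᵥ D.mA) := neg_pos.mpr hD.drift_neg
  set v := res (D.visits (upper k j)) with hv
  -- The origin is shifted to level k + 1: strictly above it the source 1_y vanishes, so both sides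
  -- solve the homogeneous equation.
  refine sub_eq_zero.mp (toeplitz_unique hP hfin (φ := fun m => v (k + 1 + m) - G ^ m *ᵥ v (k + 1))
    (by simp) (a := 2 * ∑ j, |D.kappa g j| + 1 / -(w ⬝ᵥ D.mA) * (k + 1) + ∑ j, |v (k + 1) j|)
    (b := 1 / -(w ⬝ᵥ D.mA)) (by positivity) (fun m i => ?_) (fun m i => ?_) m)
  · have h1 := (visits_le_descent hfin (upper k j) (k + 1 + m) i).trans
      (descentReal_le hD hfin hG hg (k + 1 + m) i)
    have h2 := hG.abs_pow_mulVec_le m (v (k + 1)) i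
    have h3 := abs_sub (v (k + 1 + m) i) ((G ^ m *ᵥ v (k + 1)) i)
    push_cast at h1
    simp only [Pi.sub_apply]
    rw [← hv] at h1
    linarith
  · have h1 := hasSum_inc_visits hP hfin (upper k j) (k + 1 + m) i
    have h2 := Pi.hasSum.mp (hG.hasSum_inc_mulVec m (v (k + 1))) i
    refine hasSum_of_eq (h1.sub h2) (fun n => ?_) ?_
    · rw [mulVec_sub, Pi.sub_apply, add_assoc (k + 1) m n]
    · rw [Pi.single_eq_of_ne, sub_zero]
      · rfl
      · intro h
        have := congrArg Sigma.fst h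
        simp [upper] at this
        omega

/-- The source lies in level 0 and is invisible to the equation on positive levels. This justifies
the value 0 of `FplusDiag` at k = 0. -/
lemma visits_ground (hD : D.Standing w) (hfin : ∀ x, D.descent x ≠ ⊤) (hG : D.IsG G)
    (hg : g ⬝ᵥ 1 = 1) (j : Fin M₀) (m : ℕ) : res (D.visits (ground j)) m = 0 := by
  classical
  have hP := hD.stochastic
  have hσ : 0 < -(w ⬝ᵥ D.mA) := neg_pos.mpr hD.drift_neg
  refine toeplitz_unique hP hfin rfl (b := 1 / -(w ⬝ᵥ D.mA)) (by positivity)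
    (fun m i => (visits_le_descent hfin (ground j) m i).trans
      (descentReal_le hD hfin hG hg m i)) (fun m i => ?_) m
  refine hasSum_of_eq (hasSum_inc_visits hP hfin (ground j) m i) (fun n => rfl) ?_
  rw [Pi.single_eq_of_ne, sub_zero]
  intro h
  have := congrArg Sigma.fst h
  simp [upper, ground] at this

/-- The vector `(I - Φ(0))⁻¹ B(-1) f(0)`. -/
def landing (D : Blocks M₀ M₁) (G : Matrix (Fin M₁) (Fin M₁) ℝ) (f : State M₀ M₁ → ℝ) :
    Fin M₁ → ℝ :=
  (1 - ∑' m, D.A m * G ^ m)⁻¹ *ᵥ (D.Bdown *ᵥ fun j => f (ground j))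

/-- On positive levels the Poisson equation has three sources, one per summand: the visits carry
-1_y, the descent times +π(y), and the extension the boundary term B(-1) f(0) seen from level 1. -/
theorem deviation_eq (hD : D.Standing w) (hfin : ∀ x, D.descent x ≠ ⊤) (hG : D.IsG G)
    (hp : IsStationary D.transition p) (s y : State M₀ M₁) (m : ℕ) :
    res (D.deviation p s y) m = res (D.visits y) m
      + extend G (D.landing G (D.deviation p s y)) m - p y • D.descentReal m := by
  classical
  have hP := hD.stochastic
  set f := D.deviation p s y with hf
  have hh := hp.meanHit_finite hP hD.irreducible s
  set κ : ℝ≥0∞ := ∑ i, pot (taboo D.transition {s}) 1 (ground i) with hκ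
  have hκtop : κ ≠ ⊤ := ENNReal.sum_ne_top.mpr fun i _ => hh _
  -- From a positive level, s is hit within the descent time plus the worst time from level 0, which
  -- κ bounds.
  have hbound : ∀ m i, |res f m i| ≤ (1 + p y) * κ.toReal + (1 + p y) * D.descentReal m i := by
    intro m i
    have hpy := hp.nonneg y
    cases m with
    | zero =>
      simp only [res, Pi.zero_apply, abs_zero]
      have : 0 ≤ D.descentReal 0 i := ENNReal.toReal_nonneg
      have := κ.toReal_nonneg
      positivity
    | succ m =>
      have h1 : pot (taboo D.transition {s}) 1 (upper m i) ≤ D.descent (upper m i) + κ := by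
        refine pot_singleton_le hP s (levelSet M₀ M₁ 0) κ ?_ _
        refine forall_state.mpr ⟨fun j _ => ?_, fun l j h => absurd h (Nat.succ_ne_zero l)⟩
        exact Finset.single_le_sum (f := fun i => pot (taboo D.transition {s}) 1 (ground i))
          (fun _ _ => zero_le) (Finset.mem_univ j)
      have h2 := ENNReal.toReal_mono (ENNReal.add_ne_top.mpr ⟨hfin _, hκtop⟩) h1
      rw [ENNReal.toReal_add (hfin _) hκtop] at h2
      have h3 := ENNReal.toReal_mono (hh _) (pot_single_le (P := D.transition) {s} (upper m i) y)
      have h4 : (0 : ℝ) ≤ (pot (taboo D.transition {s}) (Pi.single y 1) (upper m i)).toReal :=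
        ENNReal.toReal_nonneg
      have h5 : (0 : ℝ) ≤ (pot (taboo D.transition {s}) 1 (upper m i)).toReal :=
        ENNReal.toReal_nonneg
      have h6 := mul_le_mul_of_nonneg_left h2 hpy
      have h7 := mul_nonneg hpy h5
      have h8 : D.descentReal (m + 1) i = (D.descent (upper m i)).toReal := rfl
      rw [h8, ← mul_add, add_comm κ.toReal]
      simp only [res, hf, deviation]
      rw [abs_le]
      constructor <;> nlinarith
  have hΦ := hG.isUnit_one_sub hP hfin
  have hland : (1 - ∑' m, D.A m * G ^ m) *ᵥ D.landing G f = D.Bdown *ᵥ fun j => f (ground j) := by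
    rw [landing, mulVec_mulVec, mul_nonsing_inv _ ((isUnit_iff_isUnit_det _).mp hΦ), one_mulVec]
  have hU : ∀ m, D.descentReal m = res (fun x => (D.descent x).toReal) m := by
    intro m
    cases m <;> rfl
  have hL : 0 ≤ ∑ j, |D.landing G f j| := Finset.sum_nonneg fun j _ => abs_nonneg _
  refine sub_eq_zero.mp (D.toeplitz_unique_of_le_descent hfin (inc_nonneg hP)
    (φ := fun m => res f m - (res (D.visits y) m + extend G (D.landing G f) m
      - p y • D.descentReal m)) ?_
    (a := (1 + p y) * κ.toReal + ∑ j, |D.landing G f j|) (b := 2 + 2 * p y)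
    (fun m i => ?_) (fun m i => ?_) m)
  · simp [hU, res, extend]
  · have h1 := hbound m i
    have h2 := visits_le_descent hfin y m i
    have h3 := hG.abs_extend_le (D.landing G f) m i
    have h4 : 0 ≤ p y * D.descentReal m i := mul_nonneg (hp.nonneg y) ENNReal.toReal_nonneg
    simp only [Pi.sub_apply, Pi.add_apply, Pi.smul_apply, smul_eq_mul]
    rw [abs_le] at h1 h2 h3 ⊢
    constructor <;> nlinarith
  · have h1 := D.hasSum_row_real m i (hp.poisson hP hD.irreducible s y (upper m i))
    have h2 := hasSum_inc_visits hP hfin y m i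
    have h3 := Pi.hasSum.mp (hG.hasSum_inc_extend hP (D.landing G f) m) i
    have h4 := (hasSum_inc_pot hP (r := 1) hfin m i).mul_left (p y)
    refine hasSum_of_eq (h1.sub ((h2.add h3).sub h4)) (fun n => ?_) ?_
    · simp only [mulVec_sub, mulVec_add, mulVec_smul, Pi.sub_apply, Pi.add_apply, Pi.smul_apply,
        smul_eq_mul, hU]
      rfl
    · rw [hland]
      simp only [Pi.sub_apply, Pi.add_apply, Pi.smul_apply, smul_eq_mul, hU, res, Pi.one_apply,
        ENNReal.toReal_one, hf, deviation, descent]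
      split_ifs
      · ring
      · simp only [Pi.zero_apply]
        ring

end Blocks

namespace Blocks

variable {M₀ M₁ : ℕ} {D : Blocks M₀ M₁} {w g : Fin M₁ → ℝ} {p : State M₀ M₁ → ℝ}
  {Ω : Type*} [MeasurableSpace Ω] {ℙ : State M₀ M₁ → Measure Ω} {Z : ℕ → Ω → State M₀ M₁}

/-! ### The difference formula -/

lemma visits_eq_pow_mulVec (hD : D.Standing w) (hfin : ∀ x, D.descent x ≠ ⊤)
    (hZ : IsMarkovChain D.transition ℙ Z) (hG : D.IsG (Gmat ℙ Z)) (hg : g ⬝ᵥ 1 = 1)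
    (k : ℕ) (j : Phase M₀ M₁ k) {L : ℕ} (hL : k ≤ L) :
    res (D.visits ⟨k, j⟩) L = Gmat ℙ Z ^ (L - k) *ᵥ fun i => FplusDiag ℙ Z k i j := by
  classical
  cases k with
  | zero =>
    refine (visits_ground hD hfin hG hg j L).trans ?_
    have : (fun i => FplusDiag ℙ Z 0 i j) = 0 := rfl
    rw [this, mulVec_zero]
  | succ k =>
    obtain ⟨m, rfl⟩ := Nat.exists_eq_add_of_le hL
    refine (visits_upper hD hfin hG hg k j m).trans ?_
    rw [Nat.add_sub_cancel_left]
    congr 1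
    funext i
    have := hZ.meanVisits_eq (levelSet M₀ M₁ 0) (upper k i) (upper k j)
    exact (congrArg ENNReal.toReal this).symm

lemma Smat_col (hZ : IsMarkovChain D.transition ℙ Z) (s : State M₀ M₁) (k : ℕ)
    (j : Phase M₀ M₁ k) :
    (fun i => Smat ℙ Z D p g s k i j) = D.landing (Gmat ℙ Z) (D.deviation p s ⟨k, j⟩)
      + p ⟨k, j⟩ • (Gmat ℙ Z *ᵥ D.kappa g) := by
  classical
  have hH : (fun i => Hzero ℙ Z p s k i j) = fun i => D.deviation p s ⟨k, j⟩ (ground i) := by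
    funext i
    simp only [Hzero, Hmat, deviation, hZ.meanVisits_eq, hZ.meanHit_eq]
    rfl
  have h1 : (fun i => ((1 - Phi0 ℙ Z D)⁻¹ * D.Bdown * Hzero ℙ Z p s k) i j)
      = D.landing (Gmat ℙ Z) (D.deviation p s ⟨k, j⟩) := by
    rw [landing, mulVec_mulVec, ← hH]
    rfl
  funext i
  rw [Pi.add_apply, ← h1, Smat, Matrix.add_apply, vecMulVec_apply, Pi.smul_apply, smul_eq_mul,
    mul_comm (p _)]
  rfl

/-- The term π(y) G^L κ coming from the descent formula is G^(L-1) applied to the second summand of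
S(k). -/
lemma deviation_eq_pow (hD : D.Standing w) (hfin : ∀ x, D.descent x ≠ ⊤)
    (hZ : IsMarkovChain D.transition ℙ Z) (hG : D.IsG (Gmat ℙ Z)) (hg : g ⬝ᵥ 1 = 1)
    (hp : IsStationary D.transition p) (s : State M₀ M₁)
    (k : ℕ) (j : Phase M₀ M₁ k) {L : ℕ} (hL : k ≤ L) (hL1 : 1 ≤ L) :
    res (D.deviation p s ⟨k, j⟩) L = Gmat ℙ Z ^ (L - k) *ᵥ (fun i => FplusDiag ℙ Z k i j)
      + Gmat ℙ Z ^ (L - 1) *ᵥ (fun i => Smat ℙ Z D p g s k i j)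
      - p ⟨k, j⟩ • D.kappa g - (p ⟨k, j⟩ / -(w ⬝ᵥ D.mA) * L) • 1 := by
  obtain ⟨l, rfl⟩ : ∃ l, L = l + 1 := ⟨L - 1, by omega⟩
  rw [deviation_eq hD hfin hG hp, visits_eq_pow_mulVec hD hfin hZ hG hg k j hL, Smat_col hZ,
    descentReal_eq hD hfin hG hg, descentFormula, Nat.add_sub_cancel, mulVec_add, mulVec_smul,
    mulVec_mulVec _ (Gmat ℙ Z ^ l), ← pow_succ, extend]
  funext i
  simp only [Pi.add_apply, Pi.sub_apply, Pi.smul_apply, smul_eq_mul, Pi.one_apply]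
  ring

lemma deviation_sub (hD : D.Standing w) (hfin : ∀ x, D.descent x ≠ ⊤)
    (hZ : IsMarkovChain D.transition ℙ Z) (hG : D.IsG (Gmat ℙ Z)) (hg : g ⬝ᵥ 1 = 1)
    (hp : IsStationary D.transition p) (s : State M₀ M₁)
    (k : ℕ) (j : Phase M₀ M₁ k) {L L' t : ℕ} (hL : k ≤ L) (hL1 : 1 ≤ L) (hL' : L' = L + (t + 1)) :
    res (D.deviation p s ⟨k, j⟩) L - res (D.deviation p s ⟨k, j⟩) L'
      = (Gmat ℙ Z ^ (L - k) - Gmat ℙ Z ^ (L' - k)) *ᵥ (fun i => FplusDiag ℙ Z k i j)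
      + (Gmat ℙ Z ^ (L - 1) - Gmat ℙ Z ^ (L' - 1)) *ᵥ (fun i => Smat ℙ Z D p g s k i j)
      + (p ⟨k, j⟩ / -(w ⬝ᵥ D.mA) * ((t : ℝ) + 1)) • 1 := by
  have hLL : (L' : ℝ) = L + (t + 1) := by rw [hL']; push_cast; ring
  rw [deviation_eq_pow hD hfin hZ hG hg hp s k j hL hL1,
    deviation_eq_pow hD hfin hZ hG hg hp s k j (L := L') (by omega) (by omega), sub_mulVec,
    sub_mulVec, hLL]
  funext i
  simp only [Pi.add_apply, Pi.sub_apply, Pi.smul_apply, smul_eq_mul, Pi.one_apply]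
  ring

/-- Once the linear drift is compensated, only bounded powers of G and constants remain above level
k, and finitely many states lie below. -/
lemma exists_deviation_bound (hD : D.Standing w) (hfin : ∀ x, D.descent x ≠ ⊤)
    (hZ : IsMarkovChain D.transition ℙ Z) (hG : D.IsG (Gmat ℙ Z)) (hg : g ⬝ᵥ 1 = 1)
    (hp : IsStationary D.transition p) (s y : State M₀ M₁) :
    ∃ c, ∀ x : State M₀ M₁,
      |D.deviation p s y x + p y / -(w ⬝ᵥ D.mA) * (x.1 : ℝ)| ≤ c := by
  obtain ⟨k, j⟩ := y
  set b : State M₀ M₁ → ℝ := fun x =>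
    |D.deviation p s ⟨k, j⟩ x + p ⟨k, j⟩ / -(w ⬝ᵥ D.mA) * (x.1 : ℝ)| with hb
  obtain ⟨c₁, hc₁⟩ := ((finite_level_le (M₀ := M₀) (M₁ := M₁) k).image b).bddAbove
  refine ⟨max c₁ (∑ i, |FplusDiag ℙ Z k i j| + ∑ i, |Smat ℙ Z D p g s k i j|
    + ∑ i, |p ⟨k, j⟩ * D.kappa g i|), fun x => ?_⟩
  by_cases hx : x.1 ≤ k
  · exact (hc₁ ⟨x, hx, rfl⟩).trans (le_max_left _ _)
  · refine le_trans ?_ (le_max_right _ _)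
    revert x
    refine forall_state.mpr ⟨fun i h => absurd (Nat.zero_le k) h, fun m i h => ?_⟩
    have h1 : k ≤ m + 1 := (not_le.mp h).le
    have h2 := congrFun (deviation_eq_pow hD hfin hZ hG hg hp s k j h1 (by omega)) i
    have h3 := hG.abs_pow_mulVec_le (m + 1 - k) (fun i => FplusDiag ℙ Z k i j) i
    have h4 := hG.abs_pow_mulVec_le (m + 1 - 1) (fun i => Smat ℙ Z D p g s k i j) i
    have h5 : |p ⟨k, j⟩ * D.kappa g i| ≤ ∑ i, |p ⟨k, j⟩ * D.kappa g i| :=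
      Finset.single_le_sum (f := fun i => |p ⟨k, j⟩ * D.kappa g i|) (fun _ _ => abs_nonneg _)
        (Finset.mem_univ i)
    simp only [res, Pi.add_apply, Pi.sub_apply, Pi.smul_apply, smul_eq_mul, Pi.one_apply,
      mul_one] at h2
    have h6 : ((upper m i : State M₀ M₁).1 : ℝ) = ((m + 1 : ℕ) : ℝ) := rfl
    rw [h2, h6, sub_add_cancel]
    rw [abs_le] at *
    constructor <;> linarith

/-- The perturbation identity for the truncated chain. -/
lemma hasSum_mul_gap (hD : D.Standing w) (hfin : ∀ x, D.descent x ≠ ⊤)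
    (hZ : IsMarkovChain D.transition ℙ Z) (hG : D.IsG (Gmat ℙ Z)) (hg : g ⬝ᵥ 1 = 1)
    (hp : IsStationary D.transition p) (s y : State M₀ M₁) {N : ℕ} (hN : 1 ≤ N)
    {q : State M₀ M₁ → ℝ} (hq : IsStationary (D.trunc N).transition q) :
    HasSum (fun x => q x * D.gap N (D.deviation p s y) x) (q y - p y) := by
  classical
  have hP := hD.stochastic
  have hR := trunc_stochastic hP hN
  set f := D.deviation p s y with hf
  obtain ⟨c, hc⟩ := exists_deviation_bound hD hfin hZ hG hg hp s y
  have hβ : 0 ≤ p y / -(w ⬝ᵥ D.mA) :=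
    div_nonneg (hp.nonneg y) (neg_pos.mpr hD.drift_neg).le
  -- A jump of the truncated chain changes the level by at most N + 1; the bounded part contributes
  -- at most 2c.
  have hinc : ∀ x z, (D.trunc N).transition x z ≠ 0 →
      |f z - f x| ≤ 2 * c + p y / -(w ⬝ᵥ D.mA) * (N + 1) := by
    intro x z hxz
    obtain ⟨h1, h2⟩ := trunc_jump x z hxz
    have h3 : (z.1 : ℝ) ≤ x.1 + N := by exact_mod_cast h1
    have h4 : (x.1 : ℝ) ≤ z.1 + 1 := by exact_mod_cast h2
    have hN0 : (0 : ℝ) ≤ N := N.cast_nonneg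
    have h5 := mul_le_mul_of_nonneg_left (show (z.1 : ℝ) - x.1 ≤ N + 1 by linarith) hβ
    have h6 := mul_le_mul_of_nonneg_left (show (x.1 : ℝ) - z.1 ≤ N + 1 by linarith) hβ
    have h7 := hc x
    have h8 := hc z
    rw [abs_le] at *
    constructor <;> linarith
  have h1 := hq.hasSum_increment hR hinc
  -- The mean increment of f under P^(N) is the Poisson right-hand side plus the gap.
  have hrow : ∀ x, ∑' z, (D.trunc N).transition x z * (f z - f x)
      = D.gap N f x - (Pi.single y 1 : State M₀ M₁ → ℝ) x + p y := by
    intro x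
    have e1 := hasSum_trunc hP hN x (hp.poisson hP hD.irreducible s y x)
    have e2 := (hR.2 x).mul_right (f x)
    refine (hasSum_of_eq (e1.sub e2) (fun z => (mul_sub _ _ _).symm) ?_).tsum_eq
    have e3 : D.gap N (fun z => (pot (taboo D.transition {s}) (Pi.single y 1) z).toReal
        - p y * (pot (taboo D.transition {s}) 1 z).toReal) x = D.gap N f x := by
      congr 1
    rw [e3, hf]
    simp only [deviation]
    ring
  simp only [hrow] at h1
  have h2 : HasSum (fun x => q x * (Pi.single y 1 : State M₀ M₁ → ℝ) x) (q y) := by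
    have := hasSum_single (f := fun x => q x * (Pi.single y 1 : State M₀ M₁ → ℝ) x) y
      (fun x hx => by simp [hx])
    simpa using this
  have h3 := hq.total.mul_right (p y)
  refine hasSum_of_eq ((h1.add h2).sub h3) (fun x => ?_) ?_ <;> ring

end Blocks

end MG1

end

/-! ### Assembly of the difference formula -/

theorem lemma4p1 {M₀ M₁ : ℕ} (hM₀ : 1 ≤ M₀) (hM₁ : 1 ≤ M₁)
    (D : MG1.Blocks M₀ M₁) (w : Fin M₁ → ℝ) (hD : D.Standing w)
    {Ω : Type*} [MeasurableSpace Ω]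
    (ℙ : MG1.State M₀ M₁ → Measure Ω) (Z : ℕ → Ω → MG1.State M₀ M₁)
    (hZ : MG1.IsMarkovChain D.transition ℙ Z)
    (p : MG1.State M₀ M₁ → ℝ) (hp : MG1.IsStationary D.transition p)
    (g : Fin M₁ → ℝ) (hg : MG1.IsStationary (MG1.Gmat ℙ Z) g)
    (s : MG1.State M₀ M₁)
    (N : ℕ) (hN : 1 ≤ N)
    (pN : MG1.State M₀ M₁ → ℝ) (hpN : MG1.IsStationary (D.trunc N).transition pN)
    (k : ℕ) (hk : k ≤ N) :
    let G := MG1.Gmat ℙ Z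
    let σ := w ⬝ᵥ D.mA
    let F := MG1.FplusDiag ℙ Z k
    let S := MG1.Smat ℙ Z D p g s k
    let πk := MG1.levelVec p k
    -- the ingredients are well defined
    (∀ x, MG1.meanHit ℙ Z {s} x ≠ ∞) ∧
    (∀ x y, MG1.meanVisits ℙ Z (MG1.levelSet M₀ M₁ 0) x y ≠ ∞) ∧
    (Summable fun m => D.A m * G ^ m) ∧
    IsUnit (1 - MG1.Phi0 ℙ Z D) ∧
    IsUnit (1 - D.Asum - vecMulVec D.mA g) ∧
    -- the series converge
    (Summable fun n => D.Bbar (N + n)) ∧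
    (Summable fun n => D.Abar (N + n)) ∧
    (Summable fun n => D.B (N + 1 + n) * (G ^ (N - k) - G ^ (N + 1 + n - k)) * F) ∧
    (Summable fun n => D.B (N + 1 + n) * (G ^ (N - 1) - G ^ (N + 1 + n - 1)) * S) ∧
    (∀ l, 1 ≤ l → Summable fun n =>
      D.A (N + 1 + n) * (G ^ (N + l - k) - G ^ (N + 1 + n + l - k)) * F) ∧
    (∀ l, 1 ≤ l → Summable fun n =>
      D.A (N + 1 + n) * (G ^ (N + l - 1) - G ^ (N + 1 + n + l - 1)) * S) ∧
    -- the difference formula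
    ∃ Q : MG1.Phase M₀ M₁ k → ℝ,
      HasSum (fun l : ℕ =>
        (fun i : Fin M₁ => pN ⟨l + 1, i⟩) ᵥ*
          ((1 / (-σ)) • vecMulVec (D.Abarbar (N - 1) *ᵥ 1) πk
            + (∑' n, D.A (N + 1 + n) * (G ^ (N + (l + 1) - k) - G ^ (N + 1 + n + (l + 1) - k)) * F)
            + (∑' n, D.A (N + 1 + n) * (G ^ (N + (l + 1) - 1) - G ^ (N + 1 + n + (l + 1) - 1)) * S)))
        Q ∧
      MG1.levelVec pN k - πk =
        (fun i : Fin M₀ => pN ⟨0, i⟩) ᵥ*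
          ((1 / (-σ)) • vecMulVec (D.Bbarbar (N - 1) *ᵥ 1) πk
            + (∑' n, D.B (N + 1 + n) * (G ^ (N - k) - G ^ (N + 1 + n - k)) * F)
            + (∑' n, D.B (N + 1 + n) * (G ^ (N - 1) - G ^ (N + 1 + n - 1)) * S))
        + Q := by
  classical
  intro G σ F S πk
  have hP := hD.stochastic
  have hfin := MG1.Blocks.descent_finite hM₀ hP hD.irreducible hp
  have hG : D.IsG (MG1.Gmat ℙ Z) := by
    rw [hZ.Gmat_eq]
    exact MG1.Blocks.isG_entryMatrix hP hfin
  have hg1 := MG1.Blocks.dotProduct_one_of_stationary hg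
  obtain ⟨TA, hTA, hTA'⟩ := MG1.exists_hasSum_tail (C := D.A)
    (fun k => MG1.Blocks.A_nonneg hP (k + 1)) hD.A_moment N
  obtain ⟨TB, hTB, hTB'⟩ := MG1.exists_hasSum_tail (C := D.B)
    (fun k => MG1.Blocks.B_nonneg hP k) hD.B_moment N
  have hTAe : D.Abarbar (N - 1) = TA := by
    rw [MG1.Blocks.Abarbar, Nat.sub_add_cancel hN]
    exact hTA.tsum_eq
  have hTBe : D.Bbarbar (N - 1) = TB := by
    rw [MG1.Blocks.Bbarbar, Nat.sub_add_cancel hN]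
    exact hTB.tsum_eq
  have sB : ∀ (a : ℕ) (b : ℕ → ℕ) (X : Matrix (Fin M₁) (MG1.Phase M₀ M₁ k) ℝ),
      Summable fun n => D.B (N + 1 + n) * (G ^ a - G ^ b n) * X := fun a b X =>
    MG1.summable_mul_mul (MG1.Blocks.summable_B hP (Nat.le_add_left 1 N))
      (fun n => hG.abs_pow_sub_le a (b n)) X
  have sA : ∀ (a : ℕ) (b : ℕ → ℕ) (X : Matrix (Fin M₁) (MG1.Phase M₀ M₁ k) ℝ),
      Summable fun n => D.A (N + 1 + n) * (G ^ a - G ^ b n) * X := fun a b X =>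
    MG1.summable_mul_mul (MG1.Blocks.summable_A hP (N + 1))
      (fun n => hG.abs_pow_sub_le a (b n)) X
  refine ⟨fun x => ?_, fun x y => ?_, hG.summable_A hP, hG.isUnit_one_sub hP hfin,
    MG1.Blocks.isUnit_one_sub_sub_vecMulVec hD.A_stochastic hD.A_irreducible hD.w_stationary
      hD.drift_neg hg1, hTB.summable, hTA.summable, sB _ _ _, sB _ _ _, fun l _ => sA _ _ _,
    fun l _ => sA _ _ _, ?_⟩
  · rw [hZ.meanHit_eq]
    exact hp.meanHit_finite hP hD.irreducible s x
  · rw [hZ.meanVisits_eq]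
    exact ne_top_of_le_ne_top (hfin x) (MG1.pot_single_le _ x y)
  · have eA : ∀ l i j, ((1 / (-σ)) • vecMulVec (D.Abarbar (N - 1) *ᵥ 1) πk
            + (∑' n, D.A (N + 1 + n) * (G ^ (N + (l + 1) - k) - G ^ (N + 1 + n + (l + 1) - k)) * F)
            + (∑' n, D.A (N + 1 + n) * (G ^ (N + (l + 1) - 1) - G ^ (N + 1 + n + (l + 1) - 1)) * S))
              i j = D.gap N (D.deviation p s ⟨k, j⟩) (MG1.upper l i) := by
      intro l i j
      have := MG1.tsum_split j (sA (N + (l + 1) - k) (fun n => N + 1 + n + (l + 1) - k) F)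
        (sA (N + (l + 1) - 1) (fun n => N + 1 + n + (l + 1) - 1) S) hTA'
        (fun t => MG1.Blocks.deviation_sub hD hfin hZ hG hg1 hp s k j (L := N + (l + 1))
          (L' := N + 1 + t + (l + 1)) (t := t) (by omega) (by omega) (by omega)) i
      refine Eq.trans ?_ this.symm
      rw [Matrix.add_apply, Matrix.add_apply, Matrix.smul_apply, vecMulVec_apply, hTAe, smul_eq_mul]
      congr 2
      simp only [πk, MG1.levelVec, σ]
      ring
    have eB : ∀ i j, ((1 / (-σ)) • vecMulVec (D.Bbarbar (N - 1) *ᵥ 1) πk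
            + (∑' n, D.B (N + 1 + n) * (G ^ (N - k) - G ^ (N + 1 + n - k)) * F)
            + (∑' n, D.B (N + 1 + n) * (G ^ (N - 1) - G ^ (N + 1 + n - 1)) * S))
              i j = D.gap N (D.deviation p s ⟨k, j⟩) (MG1.ground i) := by
      intro i j
      have := MG1.tsum_split j (sB (N - k) (fun n => N + 1 + n - k) F)
        (sB (N - 1) (fun n => N + 1 + n - 1) S) hTB'
        (fun t => MG1.Blocks.deviation_sub hD hfin hZ hG hg1 hp s k j (L := N)
          (L' := N + 1 + t) (t := t) hk hN (by omega)) i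
      refine Eq.trans ?_ this.symm
      rw [Matrix.add_apply, Matrix.add_apply, Matrix.smul_apply, vecMulVec_apply, hTBe, smul_eq_mul]
      congr 2
      simp only [πk, MG1.levelVec, σ]
      ring
    have hsum : ∀ j, HasSum (fun l => ∑ i : Fin M₁, pN (MG1.upper l i)
        * D.gap N (D.deviation p s ⟨k, j⟩) (MG1.upper l i))
        (pN ⟨k, j⟩ - p ⟨k, j⟩ - ∑ i : Fin M₀, pN (MG1.ground i)
          * D.gap N (D.deviation p s ⟨k, j⟩) (MG1.ground i)) := by
      intro j
      have h1 := MG1.hasSum_levelSum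
        (MG1.Blocks.hasSum_mul_gap hD hfin hZ hG hg1 hp s ⟨k, j⟩ hN hpN)
      -- Level 0 is split off, so that the remaining series over ℓ ≥ 1 is `Q`.
      have h2 := (hasSum_nat_add_iff' 1).mpr h1
      rw [Finset.sum_range_one] at h2
      exact h2
    refine ⟨_, Pi.hasSum.mpr fun j => MG1.hasSum_of_eq (hsum j) (fun l => ?_) rfl, ?_⟩
    · simp only [vecMul, dotProduct]
      exact Finset.sum_congr rfl fun i _ => by rw [eA]; rfl
    · funext j
      simp only [Pi.sub_apply, Pi.add_apply, vecMul, dotProduct, eB]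
      exact (add_sub_cancel _ _).symm
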